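/- Let $d\ge 2$, let $\nu$ be a probability measure on $[0,+\infty)$ with bounded support and $\nu(\{0\})\neq 1$, and let $h:[0,+\infty)\times[0,+\infty)\to\mathbb{R}$ be one of the functions $h(a,b)=(a+b)^{\gamma}$ with a fixed $\gamma>0$, $h(a,b)=\min(a,b)$, or $h(a,b)=\max(a,b)$. For $\lambda>0$ let $\xi$ be a homogeneous Poisson point process on $\mathbb{R}^d$ with intensity $\lambda$ and, conditionally on $\xi$, let the marks $(E_x)_{x\in\xi}$ be i.i.d. random variables with law $\nu$. Let $P$ denote the law of the resulting marked point process $\omega=\{(x,E_x):x\in\xi\}$ on the space of locally finite sets of marked points, equipped with the $\sigma$-algebra generated by the numbers of elements of $\omega$ in Borel sets of $\mathbb{R}^d\times[0,+\infty)$. Let $\mathcal{G}(h,\lambda)$ be the random graph with vertex set $\xi$ in which two points $x\neq y$ of $\xi$ are joined by an edge if and only if $|x-y|\le h(E_x,E_y)$, where $|\cdot|$ is the Euclidean norm. A graph with vertices in $\mathbb{R}^d$ is said to percolate if it has an unbounded connected component. Then there exists $\lambda_c\in(0,+\infty)$, depending only on $d$, $h$ and $\nu$, such that for every $\lambda>0$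 $$P\bigl(\mathcal{G}(h,\lambda)\text{ percolates}\bigr)=\begin{cases}1 & \text{if } \lambda>\lambda_c,\\ 0 & \text{if } \lambda<\lambda_c.\end{cases}$$ -/

import Mathlib

open MeasureTheory ProbabilityTheory
open scoped NNReal

/-- The σ-algebra on `Ω` generated by a random set of points `ζ : Ω → Set X`, that is, by the
events `{|ζ ∩ A| = n}` with `A` a measurable subset of `X` and `n` a natural number. -/
abbrev countingSigma {Ω X : Type*} [MeasurableSpace X] (ζ : Ω → Set X) : MeasurableSpace Ω :=
  MeasurableSpace.generateFrom
    {S | ∃ A : Set X, MeasurableSet A ∧ ∃ n : ℕ, S = {ω | (ζ ω ∩ A).encard = n}}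

/-- A locally finite set `ω = {(x, E_x) : x ∈ ξ}` of marked points of `ℝ^d`, with marks in `M`. -/
structure MarkedConfiguration (d : ℕ) (M : Type*) where
  /-- The set of the pairs `(x, E_x)`. -/
  carrier : Set (EuclideanSpace ℝ (Fin d) × M)
  /-- Every point has exactly one mark. -/
  mark_unique : ∀ x a b, (x, a) ∈ carrier → (x, b) ∈ carrier → a = b
  /-- Every bounded region contains finitely many points. -/
  locally_finite : ∀ B : Set (EuclideanSpace ℝ (Fin d)), Bornology.IsBounded B →
    (Prod.fst '' carrier ∩ B).Finite

namespace MarkedConfiguration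

/-- The set `ξ` of points of `ω`, without their marks. -/
def points {d : ℕ} {M : Type*} (ω : MarkedConfiguration d M) : Set (EuclideanSpace ℝ (Fin d)) :=
  Prod.fst '' ω.carrier

/-- The space of marked configurations carries the σ-algebra generated by the numbers of marked
points in the measurable subsets of `ℝ^d × M`. -/
instance instMeasurableSpace {d : ℕ} {M : Type*} [MeasurableSpace M] :
    MeasurableSpace (MarkedConfiguration d M) :=
  countingSigma carrier

/-- The σ-algebra generated by the points `ξ` (without marks) consists of events. -/
theorem countingSigma_points_le {d : ℕ} {M : Type*} [MeasurableSpace M] :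
    countingSigma (points (d := d) (M := M)) ≤ instMeasurableSpace := by
  refine MeasurableSpace.generateFrom_le ?_
  rintro S ⟨A, hA, n, rfl⟩
  refine MeasurableSpace.measurableSet_generateFrom
    ⟨Prod.fst ⁻¹' A, hA.preimage measurable_fst, n, ?_⟩
  ext ω
  have h : points ω ∩ A = Prod.fst '' (ω.carrier ∩ Prod.fst ⁻¹' A) := by
    rw [Set.image_inter_preimage]; rfl
  have hinj : Set.InjOn Prod.fst (ω.carrier ∩ Prod.fst ⁻¹' A) := by
    rintro ⟨x, a⟩ ⟨hx, -⟩ ⟨y, b⟩ ⟨hy, -⟩ hxy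
    obtain rfl : x = y := hxy
    rw [ω.mark_unique x a b hx hy]
  simp only [Set.mem_ofPred_eq, h, hinj.encard_image]

end MarkedConfiguration

/-- Under `P`, the random set of points `ξ` is a homogeneous Poisson point process on `ℝ^d` with
intensity `lam`: it is locally finite, the number of points in a bounded Borel set `B` is Poisson
distributed with parameter `lam` times the Lebesgue measure of `B`, and the numbers of points in
finitely many pairwise disjoint bounded Borel sets are independent. -/
structure IsPoissonPointProcess {d : ℕ} {Ω : Type*} [MeasurableSpace Ω] (P : Measure Ω)
    (ξ : Ω → Set (EuclideanSpace ℝ (Fin d))) (lam : ℝ≥0) : Prop where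
  locally_finite : ∀ ω, ∀ B : Set (EuclideanSpace ℝ (Fin d)), Bornology.IsBounded B →
    (ξ ω ∩ B).Finite
  hasLaw_count : ∀ B : Set (EuclideanSpace ℝ (Fin d)), Bornology.IsBounded B → MeasurableSet B →
    HasLaw (fun ω => (ξ ω ∩ B).ncard) (poissonMeasure (lam * (volume B).toNNReal)) P
  indep_count : ∀ (n : ℕ) (B : Fin n → Set (EuclideanSpace ℝ (Fin d))),
    (∀ i, Bornology.IsBounded (B i)) → (∀ i, MeasurableSet (B i)) →
    (∀ i j, i ≠ j → Disjoint (B i) (B j)) →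
    iIndepFun (fun (i : Fin n) ω => (ξ ω ∩ B i).ncard) P

/-- `P` is the law of the `ν`-randomization of a Poisson point process with intensity `lam`: the
points `ξ` form a Poisson point process with intensity `lam`, and, conditionally on `ξ`, the marks
of the points are i.i.d. with distribution `ν`. The latter says that for pairwise disjoint bounded
Borel sets `B i` and measurable sets `U i` of marks, the conditional probability given `ξ` that all
the points of `ξ` in `B i` have their marks in `U i`, for all `i`, is the product of
`ν (U i) ^ |ξ ∩ B i|`. -/
structure IsRandomizedPoissonProcess {d : ℕ} {M : Type*} [MeasurableSpace M]
    (P : Measure (MarkedConfiguration d M)) (lam : ℝ≥0) (ν : Measure M) : Prop where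
  isProbabilityMeasure : IsProbabilityMeasure P
  poisson_points : IsPoissonPointProcess P MarkedConfiguration.points lam
  iid_marks : ∀ (n : ℕ) (B : Fin n → Set (EuclideanSpace ℝ (Fin d))) (U : Fin n → Set M),
    (∀ i, Bornology.IsBounded (B i)) → (∀ i, MeasurableSet (B i)) →
    (∀ i j, i ≠ j → Disjoint (B i) (B j)) → (∀ i, MeasurableSet (U i)) →
    P[Set.indicator {ω | ∀ i, ∀ x ∈ B i, ∀ a, (x, a) ∈ ω.carrier → a ∈ U i} (fun _ => (1 : ℝ)) |
        countingSigma MarkedConfiguration.points]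
      =ᵐ[P] fun ω => ∏ i, ν.real (U i) ^ (ω.points ∩ B i).ncard

/-- A symmetric structural function `h : M × M → ℝ`. -/
structure StructuralFunction (M : Type*) where
  /-- The underlying function. -/
  toFun : M → M → ℝ
  symm : ∀ a b, toFun a b = toFun b a

namespace StructuralFunction

/-- `h(a, b) = (a + b)^γ`. -/
noncomputable def sumPow (γ : ℝ) : StructuralFunction ℝ≥0 where
  toFun a b := ((a : ℝ) + (b : ℝ)) ^ γ
  symm a b := by rw [add_comm]

/-- `h(a, b) = min(a, b)`. -/
noncomputable def minKernel : StructuralFunction ℝ≥0 where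
  toFun a b := min (a : ℝ) (b : ℝ)
  symm _ _ := min_comm _ _

/-- `h(a, b) = max(a, b)`. -/
noncomputable def maxKernel : StructuralFunction ℝ≥0 where
  toFun a b := max (a : ℝ) (b : ℝ)
  symm _ _ := max_comm _ _

end StructuralFunction

/-- The graph with vertex set `ξ` and with edges the pairs `{x, y}` of distinct points such that
`|x - y| ≤ h(E_x, E_y)`. -/
def booleanGraph {d : ℕ} {M : Type*} (h : StructuralFunction M) (ω : MarkedConfiguration d M) :
    SimpleGraph ω.points where
  Adj x y := x ≠ y ∧ ∃ a b, (x.1, a) ∈ ω.carrier ∧ (y.1, b) ∈ ω.carrier ∧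
    dist x.1 y.1 ≤ h.toFun a b
  symm := ⟨by
    rintro x y ⟨hne, a, b, ha, hb, hab⟩
    exact ⟨hne.symm, b, a, hb, ha, by rwa [dist_comm, h.symm]⟩⟩
  loopless := ⟨fun x hx => hx.1 rfl⟩

/-- A graph with vertices in `ℝ^d` percolates if it has an unbounded connected component. -/
def Percolates {d : ℕ} {V : Set (EuclideanSpace ℝ (Fin d))} (G : SimpleGraph V) : Prop :=
  ∃ C : G.ConnectedComponent, ¬ Bornology.IsBounded (Subtype.val '' C.supp)

/-!
Fix the mark distribution `ν`, and write `μ` for the product of Lebesgue measure and `ν`. All that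
is used of the marked process `ω` with intensity `λ` is its void probabilities: a finite union `A`
of bounded rectangles contains no marked point with probability `exp (-λ μ(A))`
(`IsRandomizedPoissonProcess.hasPoissonVoidProbabilities`), together with the independence of the
numbers of points in disjoint cubes. Void events form a π-system, and they generate the σ-algebra
because a counting variable of a rectangle can be read off from the void events of small pieces of
the rectangle. Hence the void probabilities determine the law
(`HasPoissonVoidProbabilities.unique`).

*Monotonicity in the intensity.* A process with intensity `λ' > λ` has the law of the superposition
of a process with intensity `λ` and an independent one with intensity `λ' - λ`. The latter exists
because scaling the former process changes its intensity by an arbitrary factor. So the probability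
of the increasing event of percolation does not decrease with the intensity
(`HasPoissonVoidProbabilities.measure_le_of_lt`).

*Zero-one law.* Edges have bounded lengths, so that percolation is not affected by the removal of
the finitely many points in a ball (`percolates_outside_iff`). By the product form of the void
probabilities, percolation is therefore independent of the configuration in every ball, hence of
itself (`HasPoissonVoidProbabilities.measure_eq_zero_or_one`).

*Small intensity.* An unbounded cluster visits self-avoiding paths, of any length `n`, of occupied
cubes whose side is an upper bound for the lengths of the edges. The expected number of such paths from a given
cube is at most `(3 ^ d p) ^ n`, where `p` is the probability that a cube is occupied
(`IsPoissonPointProcess.ae_not_percolates`).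

*Large intensity.* Points whose marks are at least some `t > 0` are joined by an edge as soon as
they lie in adjacent cubes of a small side. Call the cubes along a quadrant of a coordinate plane
sites; a site is closed if its cube contains no such point. Planar duality is avoided by a
renormalization: a block of `3 × 3` sites is good if at most one of them is bad, and the good sites
of a good block are connected to each other and to those of adjacent good blocks
(`IsConnectivity.coarsen`). Iterating this, a bad block of scale `k` contains `2 ^ k` closed sites,
in one of at most `81 ^ 2 ^ k` possible positions, and with probability at least `2 / 3` all blocks
at the origin are good if sites are closed with probability at most `1 / 324`
(`HasPoissonVoidProbabilities.measure_percolates_ne_zero`).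

The critical intensity is then the supremum of the intensities without percolation.
-/

open scoped ENNReal

local notation "𝔼[" d "]" => EuclideanSpace ℝ (Fin d)

namespace MarkedConfiguration

variable {d : ℕ} {M : Type*}

/-! ### Counting measures and measurability of existential events -/

/-- The void event of `A`: no marked point lies in `A`. -/
def voidEvent (A : Set (𝔼[d] × M)) : Set (MarkedConfiguration d M) :=
  {ω | ω.carrier ∩ A = ∅}

lemma mem_voidEvent {A : Set (𝔼[d] × M)} {ω : MarkedConfiguration d M} :
    ω ∈ voidEvent A ↔ ∀ p ∈ ω.carrier, p ∉ A := by
  simp only [voidEvent, Set.mem_ofPred_eq, Set.eq_empty_iff_forall_notMem, Set.mem_inter_iff,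
    not_and]

lemma voidEvent_inter (A B : Set (𝔼[d] × M)) :
    (voidEvent A ∩ voidEvent B : Set (MarkedConfiguration d M)) = voidEvent (A ∪ B) := by
  ext ω
  simp only [Set.mem_inter_iff, mem_voidEvent, Set.mem_union]
  grind

lemma finite_carrier_inter (ω : MarkedConfiguration d M) {B : Set 𝔼[d]}
    (hB : Bornology.IsBounded B) (U : Set M) : (ω.carrier ∩ B ×ˢ U).Finite := by
  refine Set.Finite.of_finite_image (f := Prod.fst) ?_ ?_
  · refine (ω.locally_finite B hB).subset ?_
    rintro _ ⟨p, ⟨hp, hpB, -⟩, rfl⟩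
    exact ⟨⟨p, hp, rfl⟩, hpB⟩
  · rintro ⟨x, a⟩ ⟨hx, -⟩ ⟨y, b⟩ ⟨hy, -⟩ hxy
    obtain rfl : x = y := hxy
    rw [ω.mark_unique x a b hx hy]

/-- The shell of the points at distance between `j` and `j + 1` from the origin. The shells
partition the space into countably many bounded sets. -/
def shell (d j : ℕ) : Set 𝔼[d] := {x | ⌊‖x‖⌋₊ = j}

lemma measurableSet_shell (d j : ℕ) : MeasurableSet (shell d j) :=
  (Nat.measurable_floor.comp measurable_norm) (measurableSet_singleton j)

lemma isBounded_shell (d j : ℕ) : Bornology.IsBounded (shell d j) := by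
  refine (Metric.isBounded_closedBall (x := (0 : 𝔼[d])) (r := j + 1)).subset fun x hx => ?_
  have h : ⌊‖x‖⌋₊ = j := hx
  have := Nat.lt_floor_add_one ‖x‖
  rw [h] at this
  simpa using this.le

lemma countable_carrier (ω : MarkedConfiguration d M) : ω.carrier.Countable := by
  have : ω.carrier = ⋃ j, ω.carrier ∩ shell d j ×ˢ Set.univ := by
    ext p
    simp [shell]
  rw [this]
  exact Set.countable_iUnion fun j => (finite_carrier_inter ω (isBounded_shell d j) _).countable

/-- At least `n` points lie in a rectangle if and only if `n` disjoint members of a countable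
topological basis cut out rectangles that are not void. -/
lemma natCast_le_encard_iff (ω : MarkedConfiguration d M) (B : Set 𝔼[d]) (U : Set M) (n : ℕ) :
    n ≤ (ω.carrier ∩ B ×ˢ U).encard ↔
      ∃ O : Fin n → TopologicalSpace.countableBasis 𝔼[d],
        (Pairwise fun i j => Disjoint (O i : Set 𝔼[d]) (O j)) ∧
          ∀ i, ω ∉ voidEvent ((B ∩ O i) ×ˢ U) := by
  constructor
  · intro h
    obtain ⟨t, ht, htn⟩ := Set.exists_subset_encard_eq h
    have htf : t.Finite := Set.finite_of_encard_eq_coe htn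
    have hinj : Set.InjOn Prod.fst t := by
      rintro ⟨x, a⟩ hx ⟨y, b⟩ hy hxy
      obtain rfl : x = y := hxy
      rw [ω.mark_unique x a b (ht hx).1 (ht hy).1]
    obtain ⟨V, hV, hVd⟩ := (htf.image Prod.fst).t2_separation
    have hO : ∀ x : 𝔼[d], ∃ O ∈ TopologicalSpace.countableBasis 𝔼[d], x ∈ O ∧ O ⊆ V x := fun x =>
      (TopologicalSpace.isBasis_countableBasis 𝔼[d]).exists_subset_of_mem_open (hV x).1 (hV x).2
    choose O hOb hxO hOV using hO
    have hcard : Nat.card t = n := by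
      rw [Nat.card_coe_set_eq, Set.ncard, htn]; rfl
    have := htf.to_subtype
    let e : Fin n ≃ t := (Finite.equivFinOfCardEq hcard).symm
    refine ⟨fun i => ⟨O (e i).1.1, hOb _⟩, fun i j hij => ?_, fun i hi => ?_⟩
    · refine Set.disjoint_of_subset (hOV _) (hOV _) (hVd ⟨_, (e i).2, rfl⟩ ⟨_, (e j).2, rfl⟩ ?_)
      intro h
      exact hij (e.injective (Subtype.ext (hinj (e i).2 (e j).2 h)))
    · exact mem_voidEvent.mp hi _ (ht (e i).2).1 ⟨⟨(ht (e i).2).2.1, hxO _⟩, (ht (e i).2).2.2⟩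
  · rintro ⟨O, hOd, hO⟩
    have : ∀ i, ∃ p ∈ ω.carrier, p ∈ (B ∩ O i) ×ˢ U := by
      intro i
      by_contra! h
      exact hO i (mem_voidEvent.mpr h)
    choose p hp hpO using this
    have hinj : Function.Injective p := by
      intro i j hij
      by_contra hne
      exact Set.disjoint_left.mp (hOd hne) (hpO i).1.2 (hij ▸ (hpO j).1.2)
    calc (n : ℕ∞) = (Set.range p).encard := by
          rw [← Set.image_univ, hinj.encard_image, Set.encard_univ]; simp
      _ ≤ _ := Set.encard_le_encard (by
          rintro _ ⟨i, rfl⟩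
          exact ⟨hp i, (hpO i).1.1, (hpO i).2⟩)

variable [MeasurableSpace M]

lemma measurableSet_encard_eq {A : Set (𝔼[d] × M)} (hA : MeasurableSet A) (n : ℕ) :
    MeasurableSet {ω : MarkedConfiguration d M | (ω.carrier ∩ A).encard = n} :=
  MeasurableSpace.measurableSet_generateFrom ⟨A, hA, n, rfl⟩

lemma measurableSet_voidEvent {A : Set (𝔼[d] × M)} (hA : MeasurableSet A) :
    MeasurableSet (voidEvent A : Set (MarkedConfiguration d M)) := by
  simpa [voidEvent] using measurableSet_encard_eq hA 0

/-- The counting measure of a marked configuration. -/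
noncomputable def countingMeasure (ω : MarkedConfiguration d M) : Measure (𝔼[d] × M) :=
  Measure.count.restrict ω.carrier

lemma measurable_of_measurableSet_eq_natCast {α : Type*} [MeasurableSpace α] {f : α → ℕ∞}
    (hf : ∀ n : ℕ, MeasurableSet {x | f x = n}) : Measurable f := by
  refine measurable_to_countable' fun n => ?_
  induction n using ENat.recTopCoe with
  | coe n => exact hf n
  | top =>
    have : f ⁻¹' {⊤} = (⋃ n : ℕ, {x | f x = n})ᶜ := by
      ext x
      simp only [Set.mem_preimage, Set.mem_singleton_iff, Set.mem_compl_iff, Set.mem_iUnion,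
        Set.mem_ofPred_eq, not_exists]
      constructor
      · intro h n
        simp [h]
      · intro h
        by_contra h'
        obtain ⟨n, hn⟩ := ENat.ne_top_iff_exists.mp h'
        exact h n hn.symm
    rw [this]
    exact (MeasurableSet.iUnion hf).compl

lemma countingMeasure_eq_tsum (ω : MarkedConfiguration d M) {A : Set (𝔼[d] × M)}
    (hA : MeasurableSet A) :
    countingMeasure ω A = ∑' j, countingMeasure ω (A ∩ shell d j ×ˢ Set.univ) := by
  rw [← measure_iUnion]
  · congr 1
    ext p
    simp [shell]
  · intro i j hij
    refine Set.disjoint_left.mpr ?_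
    rintro p ⟨-, hp, -⟩ ⟨-, hp', -⟩
    exact hij (hp.symm.trans hp')
  · exact fun j => hA.inter ((measurableSet_shell d j).prod .univ)

variable [MeasurableSingletonClass M]

lemma countingMeasure_apply (ω : MarkedConfiguration d M) (A : Set (𝔼[d] × M))
    (hA : MeasurableSet A) :
    countingMeasure ω A = ((ω.carrier ∩ A).encard : ℝ≥0∞) := by
  rw [countingMeasure, Measure.restrict_apply hA, Set.inter_comm,
    Measure.count_apply (ω.countable_carrier.mono Set.inter_subset_left).measurableSet]

lemma countingMeasure_lt_top (ω : MarkedConfiguration d M) {B : Set 𝔼[d]}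
    (hB : Bornology.IsBounded B) (hBm : MeasurableSet B) {U : Set M} (hU : MeasurableSet U) :
    countingMeasure ω (B ×ˢ U) < ∞ := by
  rw [countingMeasure_apply _ _ (hBm.prod hU)]
  have := Set.encard_lt_top_iff.mpr (finite_carrier_inter ω hB U)
  exact_mod_cast this

lemma measurable_countingMeasure :
    Measurable (countingMeasure : MarkedConfiguration d M → Measure (𝔼[d] × M)) := by
  refine Measure.measurable_of_measurable_coe _ fun A hA => ?_
  simp_rw [fun ω : MarkedConfiguration d M => countingMeasure_apply ω A hA]
  exact (Measurable.of_discrete (f := fun n : ℕ∞ => (n : ℝ≥0∞))).comp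
    (measurable_of_measurableSet_eq_natCast (measurableSet_encard_eq hA))

/-- The counting measures of the configurations, as a kernel. -/
noncomputable def countingKernel (d : ℕ) (M : Type*) [MeasurableSpace M]
    [MeasurableSingletonClass M] : Kernel (MarkedConfiguration d M) (𝔼[d] × M) where
  toFun := countingMeasure
  measurable' := measurable_countingMeasure

/-- The kernel `countingKernel` is an s-finite kernel: it is the sum of its restrictions to the
shells and to the events that fix the number of points in the shell. -/
instance instIsSFiniteKernelCountingKernel : IsSFiniteKernel (countingKernel d M) := by
  classical
  have hK : ∀ j, MeasurableSet (shell d j ×ˢ (Set.univ : Set M)) :=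
    fun j => (measurableSet_shell d j).prod .univ
  have hN : ∀ j n : ℕ, MeasurableSet {ω : MarkedConfiguration d M |
      (ω.carrier ∩ shell d j ×ˢ Set.univ).encard = n} := fun j n => measurableSet_encard_eq (hK j) n
  let κ : ℕ × ℕ → Kernel (MarkedConfiguration d M) (𝔼[d] × M) := fun q =>
    Kernel.piecewise (hN q.1 q.2) ((countingKernel d M).restrict (hK q.1)) 0
  have hκ : ∀ q, IsFiniteKernel (κ q) := by
    intro q
    refine ⟨⟨q.2, by simp, fun ω => ?_⟩⟩
    simp only [κ, Kernel.piecewise_apply]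
    split_ifs with h
    · rw [Kernel.restrict_apply, Measure.restrict_apply .univ, Set.univ_inter]
      change countingMeasure ω _ ≤ _
      rw [countingMeasure_apply _ _ (hK _)]
      have h' : (ω.carrier ∩ shell d q.1 ×ˢ Set.univ).encard = q.2 := h
      rw [h']
      simp
    · simp
  have hsum : countingKernel d M = Kernel.sum κ := by
    ext ω A hA
    rw [Kernel.sum_apply' _ _ hA, ENNReal.tsum_prod (f := fun j n => κ (j, n) ω A)]
    change countingMeasure ω A = _
    rw [countingMeasure_eq_tsum ω hA]
    congr 1 with j
    obtain ⟨n, hn⟩ := ENat.ne_top_iff_exists.mp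
      (Set.encard_lt_top_iff.mpr (finite_carrier_inter ω (isBounded_shell d j) Set.univ)).ne
    rw [tsum_eq_single n]
    · simp only [κ, Kernel.piecewise_apply]
      rw [if_pos (show ω ∈ {ω : MarkedConfiguration d M |
        (ω.carrier ∩ shell d j ×ˢ Set.univ).encard = n} from hn.symm),
        Kernel.restrict_apply, Measure.restrict_apply hA]
      rfl
    · intro m hm
      simp only [κ, Kernel.piecewise_apply]
      rw [if_neg]
      · simp
      · intro h
        have h' : (ω.carrier ∩ shell d j ×ˢ Set.univ).encard = m := h
        rw [← hn] at h'
        exact hm (by exact_mod_cast h'.symm)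
  rw [hsum]
  exact Kernel.isSFiniteKernel_sum (hκs := fun q => inferInstance)

/-- The existence of a marked point of a random configuration satisfying a jointly measurable
condition is an event. -/
lemma measurableSet_exists_mem_carrier {α : Type*} [MeasurableSpace α]
    {g : α → MarkedConfiguration d M} (hg : Measurable g) {C : α → 𝔼[d] × M → Prop}
    (hC : MeasurableSet {q : α × (𝔼[d] × M) | C q.1 q.2}) :
    MeasurableSet {y | ∃ p ∈ (g y).carrier, C y p} := by
  have h := Kernel.measurable_kernel_prodMk_left (κ := (countingKernel d M).comap g hg) hC
  have h' : {y | ∃ p ∈ (g y).carrier, C y p} = {y | (countingKernel d M).comap g hg y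
      (Prod.mk y ⁻¹' {q : α × (𝔼[d] × M) | C q.1 q.2}) = 0}ᶜ := by
    ext y
    simp only [Set.mem_ofPred_eq, Set.mem_compl_iff, Kernel.comap_apply]
    change _ ↔ ¬ (countingMeasure (g y) _ = 0)
    rw [countingMeasure_apply _ _ (measurable_prodMk_left hC)]
    simp only [Set.preimage_ofPred_eq, ENat.toENNReal_eq_zero, Set.encard_eq_zero]
    rw [← ne_eq, ← Set.nonempty_iff_ne_empty]
    rfl
  rw [h']
  exact (h (measurableSet_singleton 0)).compl

/-! ### The σ-algebra is generated by void events -/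

/-- The σ-algebra of the configuration space is generated by the void events of bounded
rectangles. -/
lemma instMeasurableSpace_le_of_voidEvent {m : MeasurableSpace (MarkedConfiguration d M)}
    (hm : ∀ (B : Set 𝔼[d]) (U : Set M), Bornology.IsBounded B → MeasurableSet B →
      MeasurableSet U → MeasurableSet[m] (voidEvent (B ×ˢ U))) :
    instMeasurableSpace ≤ m := by
  have hle : ∀ (B : Set 𝔼[d]) (U : Set M), Bornology.IsBounded B → MeasurableSet B →
      MeasurableSet U → ∀ n : ℕ, MeasurableSet[m]
        {ω : MarkedConfiguration d M | n ≤ (ω.carrier ∩ B ×ˢ U).encard} := by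
    intro B U hB hBm hU n
    simp_rw [natCast_le_encard_iff, Set.ofPred_exists, Set.ofPred_and, Set.ofPred_forall]
    refine MeasurableSet.iUnion fun O => MeasurableSet.inter (.const _) ?_
    refine MeasurableSet.iInter fun i => (hm _ _ (hB.subset Set.inter_subset_left)
      (hBm.inter ?_) hU).compl
    exact (TopologicalSpace.isOpen_of_mem_countableBasis (O i).2).measurableSet
  have hmeas : ∀ (B : Set 𝔼[d]) (U : Set M), Bornology.IsBounded B → MeasurableSet B →
      MeasurableSet U →
        Measurable[m] (fun ω : MarkedConfiguration d M => countingMeasure ω (B ×ˢ U)) := by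
    intro B U hB hBm hU
    simp_rw [fun ω : MarkedConfiguration d M => countingMeasure_apply ω _ (hBm.prod hU)]
    refine (Measurable.of_discrete (f := fun n : ℕ∞ => (n : ℝ≥0∞))).comp
      (measurable_of_measurableSet_eq_natCast fun n => ?_)
    convert (hle B U hB hBm hU n).diff (hle B U hB hBm hU (n + 1)) using 1
    ext ω
    simp only [Set.mem_ofPred_eq, Set.mem_sdiff, not_le, Nat.cast_add, Nat.cast_one]
    rw [ENat.lt_add_one_iff (by simp)]
    exact ⟨fun h => ⟨h.ge, h.le⟩, fun h => le_antisymm h.2 h.1⟩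
  have hshell : ∀ (j : ℕ) (A : Set (𝔼[d] × M)), MeasurableSet A →
      Measurable[m] (fun ω : MarkedConfiguration d M =>
        countingMeasure ω (A ∩ shell d j ×ˢ Set.univ)) := by
    intro j A hA
    have hK : MeasurableSet (shell d j ×ˢ (Set.univ : Set M)) :=
      (measurableSet_shell d j).prod .univ
    let κ : MarkedConfiguration d M → Measure (𝔼[d] × M) :=
      fun ω => (countingMeasure ω).restrict (shell d j ×ˢ Set.univ)
    have : ∀ ω, IsFiniteMeasure (κ ω) := fun ω => ⟨by
      rw [Measure.restrict_apply .univ, Set.univ_inter]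
      exact countingMeasure_lt_top ω (isBounded_shell d j) (measurableSet_shell d j) .univ⟩
    have hκ : Measurable[m] κ := by
      refine Measurable.measure_of_isPiSystem (generateFrom_prod (α := 𝔼[d]) (β := M)).symm
        isPiSystem_prod ?_ ?_
      · rintro _ ⟨B, hB, U, hU, rfl⟩
        rw [Set.mem_ofPred_eq] at hB hU
        simp only [κ, Measure.restrict_apply (hB.prod hU), Set.prod_inter_prod, Set.inter_univ]
        exact hmeas _ _ ((isBounded_shell d j).subset Set.inter_subset_right)
          (hB.inter (measurableSet_shell d j)) hU
      · simp only [κ, Measure.restrict_apply .univ, Set.univ_inter]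
        exact hmeas _ _ (isBounded_shell d j) (measurableSet_shell d j) .univ
    have := (Measure.measurable_coe hA).comp hκ
    simpa only [Function.comp_def, κ, Measure.restrict_apply hA] using this
  refine MeasurableSpace.generateFrom_le ?_
  rintro S ⟨A, hA, n, rfl⟩
  have h1 : Measurable[m] (fun ω : MarkedConfiguration d M => countingMeasure ω A) := by
    simp_rw [fun ω : MarkedConfiguration d M => countingMeasure_eq_tsum ω hA]
    exact Measurable.tsum fun j => hshell j A hA
  convert h1 (measurableSet_singleton ((n : ℕ∞) : ℝ≥0∞)) using 1
  ext ω
  simp only [Set.mem_ofPred_eq, Set.mem_preimage, Set.mem_singleton_iff,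
    countingMeasure_apply ω A hA]
  rw [ENat.toENNReal_inj]

end MarkedConfiguration

namespace MarkedConfiguration

variable {d : ℕ} {M : Type*} [MeasurableSpace M]

/-! ### Void probabilities -/

/-- A set of marked points is a simple region if the set of the marks that it admits at a point is
a measurable function of the point with finitely many measurable values, and is empty outside a
bounded set. Simple regions are the finite unions of bounded measurable rectangles; this encoding
makes it easy to take unions of them. -/
def IsSimpleRegion (A : Set (𝔼[d] × M)) : Prop :=
  ∃ (ι : Type) (_ : Finite ι) (f : 𝔼[d] → ι) (U : ι → Set M),
    (∀ i, MeasurableSet (f ⁻¹' {i})) ∧ (∀ i, MeasurableSet (U i)) ∧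
      Bornology.IsBounded {x | (U (f x)).Nonempty} ∧ A = {p | p.2 ∈ U (f p.1)}

lemma IsSimpleRegion.union {A A' : Set (𝔼[d] × M)} (hA : IsSimpleRegion A)
    (hA' : IsSimpleRegion A') : IsSimpleRegion (A ∪ A') := by
  obtain ⟨ι, _, f, U, hf, hU, hb, rfl⟩ := hA
  obtain ⟨ι', _, f', U', hf', hU', hb', rfl⟩ := hA'
  refine ⟨ι × ι', inferInstance, fun x => (f x, f' x), fun i => U i.1 ∪ U' i.2, fun i => ?_,
    fun i => (hU _).union (hU' _), (hb.union hb').subset ?_, rfl⟩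
  · convert (hf i.1).inter (hf' i.2) using 1
    ext x
    simp [Prod.ext_iff]
  · intro x hx
    simpa only [Set.mem_union, Set.mem_ofPred_eq, Set.union_nonempty] using hx

lemma IsSimpleRegion.inter_prod_univ {A : Set (𝔼[d] × M)} (hA : IsSimpleRegion A) {B : Set 𝔼[d]}
    (hB : MeasurableSet B) : IsSimpleRegion (A ∩ B ×ˢ Set.univ) := by
  classical
  obtain ⟨ι, _, f, U, hf, hU, hb, rfl⟩ := hA
  refine ⟨ι × Prop, inferInstance, fun x => (f x, x ∈ B), fun i => {a | a ∈ U i.1 ∧ i.2},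
    fun i => ?_, fun i => ?_, hb.subset ?_, ?_⟩
  · obtain ⟨i, q⟩ := i
    have h : {x | (x ∈ B) = q} = if q then B else Bᶜ := by
      ext x
      by_cases hq : q <;> simp [hq]
    have hq : MeasurableSet {x | (x ∈ B) = q} := by
      rw [h]
      split_ifs
      exacts [hB, hB.compl]
    convert (hf i).inter hq using 1
    ext x
    simp [Prod.ext_iff]
  · exact (hU _).inter (.const _)
  · rintro x ⟨a, ha, -⟩
    exact ⟨a, ha⟩
  · ext p
    simp

lemma isSimpleRegion_prod {B : Set 𝔼[d]} {U : Set M} (hB : Bornology.IsBounded B)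
    (hBm : MeasurableSet B) (hU : MeasurableSet U) : IsSimpleRegion (B ×ˢ U) := by
  classical
  have h : ∀ q : Prop, {x | (x ∈ B) = q} = if q then B else Bᶜ := by
    intro q
    ext x
    by_cases hq : q <;> simp [hq]
  refine ⟨Prop, inferInstance, fun x => x ∈ B, fun i => {a | a ∈ U ∧ i}, fun i => ?_,
    fun i => hU.inter (.const _), hB.subset ?_, ?_⟩
  · change MeasurableSet {x | (x ∈ B) = i}
    rw [h]
    split_ifs
    exacts [hBm, hBm.compl]
  · rintro x ⟨a, -, ha⟩
    exact ha
  · ext p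
    simp [and_comm]

/-- A simple region is a disjoint union of bounded rectangles with disjoint bases. -/
lemma IsSimpleRegion.exists_eq_iUnion_prod {A : Set (𝔼[d] × M)} (hA : IsSimpleRegion A) :
    ∃ (n : ℕ) (B : Fin n → Set 𝔼[d]) (U : Fin n → Set M), (∀ i, Bornology.IsBounded (B i)) ∧
      (∀ i, MeasurableSet (B i)) ∧ (∀ i j, i ≠ j → Disjoint (B i) (B j)) ∧
      (∀ i, MeasurableSet (U i)) ∧ A = ⋃ i, B i ×ˢ U i := by
  obtain ⟨ι, _, f, U, hf, hU, hb, rfl⟩ := hA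
  let e := Finite.equivFin ι
  refine ⟨Nat.card ι, fun i => {x | f x = e.symm i ∧ (U (e.symm i)).Nonempty},
    fun i => U (e.symm i), fun i => hb.subset ?_, fun i => (hf _).inter (.const _), ?_,
    fun i => hU _, ?_⟩
  · rintro x ⟨hx, hx'⟩
    rwa [Set.mem_ofPred_eq, hx]
  · intro i j hij
    refine Set.disjoint_left.mpr ?_
    rintro x ⟨hx, -⟩ ⟨hx', -⟩
    exact hij (e.symm.injective (hx.symm.trans hx'))
  · ext p
    simp only [Set.mem_ofPred_eq, Set.mem_iUnion, Set.mem_prod]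
    constructor
    · intro h
      refine ⟨e (f p.1), ?_⟩
      rw [e.symm_apply_apply]
      exact ⟨⟨rfl, _, h⟩, h⟩
    · rintro ⟨i, ⟨hi, -⟩, h⟩
      rwa [hi]

lemma IsSimpleRegion.measurableSet {A : Set (𝔼[d] × M)} (hA : IsSimpleRegion A) :
    MeasurableSet A := by
  obtain ⟨n, B, U, -, hB, -, hU, rfl⟩ := hA.exists_eq_iUnion_prod
  exact MeasurableSet.iUnion fun i => (hB i).prod (hU i)

lemma IsSimpleRegion.exists_subset_prod_univ {A : Set (𝔼[d] × M)} (hA : IsSimpleRegion A) :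
    ∃ n : ℕ, A ⊆ Metric.closedBall (0 : 𝔼[d]) n ×ˢ Set.univ := by
  obtain ⟨ι, _, f, U, hf, hU, hb, rfl⟩ := hA
  obtain ⟨r, hr⟩ := hb.subset_closedBall 0
  obtain ⟨n, hn⟩ := exists_nat_ge r
  exact ⟨n, fun p hp => ⟨Metric.closedBall_subset_closedBall hn (hr ⟨_, hp⟩), trivial⟩⟩

lemma IsSimpleRegion.measure_ne_top {A : Set (𝔼[d] × M)} (hA : IsSimpleRegion A) (ν : Measure M)
    [IsProbabilityMeasure ν] : (volume.prod ν) A ≠ ∞ := by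
  obtain ⟨n, hn⟩ := hA.exists_subset_prod_univ
  refine ne_top_of_le_ne_top ?_ (measure_mono hn)
  rw [Measure.prod_prod, measure_univ, mul_one]
  exact measure_closedBall_lt_top.ne

/-- The void probabilities of a randomized Poisson point process with intensity `lam`: the
probability that a simple region `A` contains no marked point is `exp (-lam (volume ⊗ ν) A)`. -/
structure HasPoissonVoidProbabilities (P : Measure (MarkedConfiguration d M)) (lam : ℝ≥0)
    (ν : Measure M) : Prop where
  isProbabilityMeasure : IsProbabilityMeasure P
  real_voidEvent : ∀ A, IsSimpleRegion A →
    P.real (voidEvent A) = Real.exp (-(lam * (volume.prod ν).real A))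

lemma integral_pow_poissonMeasure (r : ℝ≥0) (t : ℝ) :
    ∫ n, t ^ n ∂(poissonMeasure r) = Real.exp (r * (t - 1)) := by
  rw [integral_poissonMeasure]
  have h := (NormedSpace.expSeries_div_hasSum_exp ((r : ℝ) * t)).mul_left (Real.exp (-r))
  rw [← Real.exp_eq_exp_ℝ, ← Real.exp_add] at h
  convert h.tsum_eq using 1
  · congr 1 with n
    rw [mul_pow, smul_eq_mul]
    ring
  · congr 1
    ring

/-- A randomized Poisson point process has the void probabilities `exp (-lam (volume ⊗ ν) A)`. -/
lemma _root_.IsRandomizedPoissonProcess.hasPoissonVoidProbabilities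
    {P : Measure (MarkedConfiguration d M)} {lam : ℝ≥0} {ν : Measure M} [IsProbabilityMeasure ν]
    (hP : IsRandomizedPoissonProcess P lam ν) : HasPoissonVoidProbabilities P lam ν := by
  have := hP.isProbabilityMeasure
  refine ⟨this, fun A hA => ?_⟩
  have hAm := hA.measurableSet
  obtain ⟨n, B, U, hB, hBm, hBd, hU, rfl⟩ := hA.exists_eq_iUnion_prod
  have hV : {ω : MarkedConfiguration d M | ∀ i, ∀ x ∈ B i, ∀ a, (x, a) ∈ ω.carrier → a ∈ (U i)ᶜ}
      = voidEvent (⋃ i, B i ×ˢ U i) := by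
    ext ω
    simp only [mem_voidEvent, Set.mem_ofPred_eq, Set.mem_iUnion, Set.mem_prod, Prod.forall,
      Set.mem_compl_iff]
    grind
  have hc := hP.iid_marks n B (fun i => (U i)ᶜ) hB hBm hBd fun i => (hU i).compl
  rw [hV] at hc
  have hlaw := fun i => hP.poisson_points.hasLaw_count (B i) (hB i) (hBm i)
  have h1 : P.real (voidEvent (⋃ i, B i ×ˢ U i)) =
      ∫ ω, ∏ i, ν.real (U i)ᶜ ^ (ω.points ∩ B i).ncard ∂P := by
    rw [← integral_congr_ae hc, integral_condExp countingSigma_points_le,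
      integral_indicator (measurableSet_voidEvent hAm)]
    simp
  have h2 : (volume.prod ν).real (⋃ i, B i ×ˢ U i) = ∑ i, volume.real (B i) * ν.real (U i) := by
    rw [measureReal_iUnion_fintype _ _ fun i => ?_]
    · simp_rw [measureReal_prod_prod]
    · intro i j hij
      exact Set.disjoint_left.mpr fun p hp hp' => Set.disjoint_left.mp (hBd i j hij) hp.1 hp'.1
    · exact fun i => (hBm i).prod (hU i)
    · rw [Measure.prod_prod]
      exact ENNReal.mul_ne_top (hB i).measure_lt_top.ne (measure_ne_top _ _)
  rw [h1, (hP.poisson_points.indep_count n B hB hBm hBd).integral_fun_prod_comp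
    (f := fun i k => ν.real (U i)ᶜ ^ k) (fun i => (hlaw i).aemeasurable) (fun i => .of_discrete),
    h2, Finset.mul_sum, ← Finset.sum_neg_distrib, Real.exp_sum]
  refine Finset.prod_congr rfl fun i _ => ?_
  have h3 := (hlaw i).integral_comp (f := fun k => ν.real (U i)ᶜ ^ k) .of_discrete
  rw [Function.comp_def] at h3
  rw [h3, integral_pow_poissonMeasure, probReal_compl_eq_one_sub (hU i)]
  congr 1
  rw [measureReal_def volume, NNReal.coe_mul, ENNReal.coe_toNNReal_eq_toReal]
  ring

lemma isPiSystem_voidEvent :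
    IsPiSystem {V : Set (MarkedConfiguration d M) | ∃ A, IsSimpleRegion A ∧ V = voidEvent A} := by
  rintro _ ⟨A, hA, rfl⟩ _ ⟨B, hB, rfl⟩ -
  exact ⟨A ∪ B, hA.union hB, voidEvent_inter A B⟩

lemma HasPoissonVoidProbabilities.measure_voidEvent {P : Measure (MarkedConfiguration d M)}
    {lam : ℝ≥0} {ν : Measure M} (hP : HasPoissonVoidProbabilities P lam ν) {A : Set (𝔼[d] × M)}
    (hA : IsSimpleRegion A) :
    P (voidEvent A) = ENNReal.ofReal (Real.exp (-(lam * (volume.prod ν).real A))) := by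
  have := hP.isProbabilityMeasure
  rw [← hP.real_voidEvent A hA, ofReal_measureReal]

section Uniqueness

variable [MeasurableSingletonClass M]

lemma instMeasurableSpace_eq_generateFrom :
    (instMeasurableSpace : MeasurableSpace (MarkedConfiguration d M)) =
      MeasurableSpace.generateFrom {V | ∃ A, IsSimpleRegion A ∧ V = voidEvent A} := by
  refine le_antisymm (instMeasurableSpace_le_of_voidEvent fun B U hB hBm hU => ?_)
    (MeasurableSpace.generateFrom_le ?_)
  · exact MeasurableSpace.measurableSet_generateFrom ⟨_, isSimpleRegion_prod hB hBm hU, rfl⟩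
  · rintro _ ⟨A, hA, rfl⟩
    exact measurableSet_voidEvent hA.measurableSet

/-- The void probabilities determine the law. -/
lemma HasPoissonVoidProbabilities.unique {P Q : Measure (MarkedConfiguration d M)}
    {lam : ℝ≥0} {ν : Measure M} (hP : HasPoissonVoidProbabilities P lam ν)
    (hQ : HasPoissonVoidProbabilities Q lam ν) : P = Q := by
  have := hP.isProbabilityMeasure
  have := hQ.isProbabilityMeasure
  refine ext_of_generate_finite _ instMeasurableSpace_eq_generateFrom isPiSystem_voidEvent ?_
    (by simp)
  rintro _ ⟨A, hA, rfl⟩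
  rw [hP.measure_voidEvent hA, hQ.measure_voidEvent hA]

lemma measurable_of_voidEvent {α : Type*} [MeasurableSpace α] {g : α → MarkedConfiguration d M}
    (hg : ∀ A, IsSimpleRegion A → MeasurableSet (g ⁻¹' voidEvent A)) : Measurable g := by
  rw [instMeasurableSpace_eq_generateFrom]
  refine measurable_generateFrom ?_
  rintro _ ⟨A, hA, rfl⟩
  exact hg A hA

end Uniqueness

end MarkedConfiguration

namespace MarkedConfiguration

variable {d : ℕ} {M : Type*}

/-! ### Scaling and superposition -/

/-- The configuration obtained by multiplying all points by `c`. -/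
def scale (c : ℝ) (hc : c ≠ 0) (ω : MarkedConfiguration d M) : MarkedConfiguration d M where
  carrier := {p | (c⁻¹ • p.1, p.2) ∈ ω.carrier}
  mark_unique x a b ha hb := ω.mark_unique _ a b ha hb
  locally_finite B hB := by
    refine ((ω.locally_finite _ (hB.smul₀ c⁻¹)).image (c • ·)).subset ?_
    rintro _ ⟨⟨p, hp, rfl⟩, hpB⟩
    exact ⟨c⁻¹ • p.1, ⟨⟨_, hp, rfl⟩, Set.smul_mem_smul_set hpB⟩, smul_inv_smul₀ hc _⟩

lemma scale_preimage_voidEvent (c : ℝ) (hc : c ≠ 0) (A : Set (𝔼[d] × M)) :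
    scale c hc ⁻¹' voidEvent A = voidEvent (Prod.map (c • ·) id ⁻¹' A) := by
  ext ω
  simp only [Set.mem_preimage, mem_voidEvent, scale, Set.mem_ofPred_eq]
  constructor
  · intro h p hp
    refine h (c • p.1, p.2) ?_
    rwa [inv_smul_smul₀ hc]
  · intro h p hp hpA
    refine h _ hp ?_
    simpa [Prod.map, smul_inv_smul₀ hc] using hpA

/-- The superposition of two configurations. Where they have a point in common, the mark of the
first configuration is retained, so that the marks remain unique. -/
def superpose (ω₁ ω₂ : MarkedConfiguration d M) : MarkedConfiguration d M where
  carrier := ω₁.carrier ∪ {p | p ∈ ω₂.carrier ∧ p.1 ∉ ω₁.points}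
  mark_unique x a b ha hb := by
    rcases ha with ha | ⟨ha, ha'⟩ <;> rcases hb with hb | ⟨hb, hb'⟩
    · exact ω₁.mark_unique x a b ha hb
    · exact absurd ⟨_, ha, rfl⟩ hb'
    · exact absurd ⟨_, hb, rfl⟩ ha'
    · exact ω₂.mark_unique x a b ha hb
  locally_finite B hB := by
    refine ((ω₁.locally_finite B hB).union (ω₂.locally_finite B hB)).subset ?_
    rintro _ ⟨⟨p, hp | ⟨hp, -⟩, rfl⟩, hpB⟩
    · exact Or.inl ⟨⟨p, hp, rfl⟩, hpB⟩
    · exact Or.inr ⟨⟨p, hp, rfl⟩, hpB⟩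

variable [MeasurableSpace M]

lemma IsSimpleRegion.preimage_smul {A : Set (𝔼[d] × M)} (hA : IsSimpleRegion A) {c : ℝ}
    (hc : c ≠ 0) : IsSimpleRegion (Prod.map (c • ·) id ⁻¹' A) := by
  obtain ⟨ι, _, f, U, hf, hU, hb, rfl⟩ := hA
  refine ⟨ι, inferInstance, fun x => f (c • x), U,
    fun i => (hf i).preimage (measurable_const_smul c), hU, (hb.smul₀ c⁻¹).subset ?_, rfl⟩
  intro x hx
  exact ⟨c • x, hx, inv_smul_smul₀ hc x⟩

lemma measureReal_preimage_smul (ν : Measure M) [IsProbabilityMeasure ν] {A : Set (𝔼[d] × M)}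
    (hA : MeasurableSet A) {c : ℝ} (hc : 0 < c) :
    (volume.prod ν).real (Prod.map (c • ·) id ⁻¹' A) = (c ^ d)⁻¹ * (volume.prod ν).real A := by
  have h := Measure.map_prod_map (volume : Measure 𝔼[d]) ν (measurable_const_smul c) measurable_id
  rw [Measure.map_id, Measure.map_addHaar_smul _ hc.ne', finrank_euclideanSpace_fin,
    abs_of_pos (by positivity)] at h
  rw [← map_measureReal_apply ((measurable_const_smul c).prodMap measurable_id) hA, ← h,
    Measure.prod_smul_left, measureReal_ennreal_smul_apply, ENNReal.toReal_ofReal (by positivity)]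

lemma HasPoissonVoidProbabilities.ae_notMem_points [Nontrivial 𝔼[d]]
    {P : Measure (MarkedConfiguration d M)} {lam : ℝ≥0} {ν : Measure M} [IsProbabilityMeasure ν]
    (hP : HasPoissonVoidProbabilities P lam ν) (x : 𝔼[d]) : ∀ᵐ ω ∂P, x ∉ ω.points := by
  have := hP.isProbabilityMeasure
  have hA : IsSimpleRegion ({x} ×ˢ Set.univ : Set (𝔼[d] × M)) :=
    isSimpleRegion_prod Bornology.isBounded_singleton (measurableSet_singleton x) .univ
  have h := hP.measure_voidEvent hA
  rw [measureReal_prod_prod, measureReal_def volume, measure_singleton] at h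
  have h' : ∀ᵐ ω ∂P, ω ∈ voidEvent ({x} ×ˢ Set.univ : Set (𝔼[d] × M)) :=
    (mem_ae_iff_prob_eq_one (measurableSet_voidEvent hA.measurableSet)).mpr (by simpa using h)
  filter_upwards [h'] with ω hω
  rintro ⟨p, hp, rfl⟩
  exact mem_voidEvent.mp hω p hp (by simp)

variable [MeasurableSingletonClass M]

lemma measurable_scale (c : ℝ) (hc : c ≠ 0) :
    Measurable (scale c hc : MarkedConfiguration d M → MarkedConfiguration d M) := by
  refine measurable_of_voidEvent fun A hA => ?_
  rw [scale_preimage_voidEvent]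
  exact measurableSet_voidEvent (hA.preimage_smul hc).measurableSet

lemma HasPoissonVoidProbabilities.scale {P : Measure (MarkedConfiguration d M)}
    {lam lam' : ℝ≥0} {ν : Measure M} [IsProbabilityMeasure ν]
    (hP : HasPoissonVoidProbabilities P lam ν) {c : ℝ} (hc : 0 < c)
    (hlam : (lam : ℝ) = lam' * c ^ d) :
    HasPoissonVoidProbabilities (P.map (scale c hc.ne')) lam' ν := by
  have := hP.isProbabilityMeasure
  refine ⟨Measure.isProbabilityMeasure_map (measurable_scale c hc.ne').aemeasurable,
    fun A hA => ?_⟩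
  rw [map_measureReal_apply (measurable_scale c hc.ne') (measurableSet_voidEvent hA.measurableSet),
    scale_preimage_voidEvent, hP.real_voidEvent _ (hA.preimage_smul hc.ne'),
    measureReal_preimage_smul ν hA.measurableSet hc, hlam]
  congr 2
  field_simp

/-- Since scaling changes the intensity, the existence of a process with one intensity yields
processes with all other intensities. -/
lemma HasPoissonVoidProbabilities.exists_intensity {P : Measure (MarkedConfiguration d M)}
    {lam lam' : ℝ≥0} {ν : Measure M} [IsProbabilityMeasure ν] (hd : d ≠ 0)
    (hP : HasPoissonVoidProbabilities P lam ν) (hlam : 0 < lam) (hlam' : 0 < lam') :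
    ∃ Q : Measure (MarkedConfiguration d M), HasPoissonVoidProbabilities Q lam' ν := by
  have h : (0 : ℝ) < lam / lam' := by positivity
  refine ⟨_, hP.scale (c := (lam / lam' : ℝ) ^ (1 / d : ℝ)) (by positivity) ?_⟩
  rw [← Real.rpow_natCast, ← Real.rpow_mul h.le, one_div_mul_cancel (by exact_mod_cast hd),
    Real.rpow_one]
  field_simp

lemma measurable_superpose : Measurable
    (fun q : MarkedConfiguration d M × MarkedConfiguration d M => superpose q.1 q.2) := by
  refine measurable_of_voidEvent fun A hA => ?_
  have h1 : MeasurableSet {q : MarkedConfiguration d M × MarkedConfiguration d M |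
      ∃ p ∈ q.1.carrier, p ∈ A} :=
    measurableSet_exists_mem_carrier measurable_fst (C := fun _ p => p ∈ A)
      (measurable_snd hA.measurableSet)
  have h2 : MeasurableSet {q : (MarkedConfiguration d M × MarkedConfiguration d M) × (𝔼[d] × M) |
      ∃ r ∈ q.1.1.carrier, r.1 = q.2.1} :=
    measurableSet_exists_mem_carrier (measurable_fst.comp measurable_fst)
      (C := fun (q : (MarkedConfiguration d M × MarkedConfiguration d M) × (𝔼[d] × M)) r =>
        r.1 = q.2.1) (measurableSet_eq_fun (by fun_prop) (by fun_prop))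
  have h3 : MeasurableSet {q : MarkedConfiguration d M × MarkedConfiguration d M |
      ∃ p ∈ q.2.carrier, p ∈ A ∧ ¬ ∃ r ∈ q.1.carrier, r.1 = p.1} :=
    measurableSet_exists_mem_carrier measurable_snd
      (C := fun (q : MarkedConfiguration d M × MarkedConfiguration d M) p => p ∈ A ∧ ¬ ∃ r ∈ q.1.carrier, r.1 = p.1)
      ((measurable_snd hA.measurableSet).inter h2.compl)
  convert h1.compl.inter h3.compl using 1
  ext q
  simp only [Set.mem_preimage, mem_voidEvent, superpose, points, Set.mem_inter_iff,
    Set.mem_compl_iff, Set.mem_ofPred_eq, Set.mem_union, Set.mem_image]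
  grind

/-- Independent processes have almost surely no point in common, so that the intensities add up
under superposition. -/
lemma HasPoissonVoidProbabilities.superpose [Nontrivial 𝔼[d]]
    {P Q : Measure (MarkedConfiguration d M)} {lam lam' : ℝ≥0} {ν : Measure M}
    [IsProbabilityMeasure ν] (hP : HasPoissonVoidProbabilities P lam ν)
    (hQ : HasPoissonVoidProbabilities Q lam' ν) :
    HasPoissonVoidProbabilities ((P.prod Q).map fun q => superpose q.1 q.2) (lam + lam') ν := by
  have := hP.isProbabilityMeasure
  have := hQ.isProbabilityMeasure
  refine ⟨Measure.isProbabilityMeasure_map measurable_superpose.aemeasurable, fun A hA => ?_⟩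
  have h1 : MeasurableSet {q : (MarkedConfiguration d M × MarkedConfiguration d M) × (𝔼[d] × M) |
      ∃ r ∈ q.1.2.carrier, r.1 = q.2.1} :=
    measurableSet_exists_mem_carrier (measurable_snd.comp measurable_fst)
      (C := fun (q : (MarkedConfiguration d M × MarkedConfiguration d M) × (𝔼[d] × M)) r =>
        r.1 = q.2.1) (measurableSet_eq_fun (by fun_prop) (by fun_prop))
  have h2 : MeasurableSet {q : MarkedConfiguration d M × MarkedConfiguration d M |
      ∃ p ∈ q.1.carrier, ∃ r ∈ q.2.carrier, r.1 = p.1} :=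
    measurableSet_exists_mem_carrier measurable_fst
      (C := fun (q : MarkedConfiguration d M × MarkedConfiguration d M) p =>
        ∃ r ∈ q.2.carrier, r.1 = p.1) h1
  have h3 : P.prod Q {q : MarkedConfiguration d M × MarkedConfiguration d M |
      ∃ p ∈ q.1.carrier, ∃ r ∈ q.2.carrier, r.1 = p.1} = 0 := by
    rw [Measure.measure_prod_null h2]
    refine Filter.Eventually.of_forall fun ω₁ => ?_
    have h4 : ∀ᵐ ω₂ ∂Q, ∀ p ∈ ω₁.carrier, p.1 ∉ ω₂.points :=
      (ae_ball_iff ω₁.countable_carrier).mpr fun p _ => hQ.ae_notMem_points p.1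
    refine measure_mono_null ?_ h4
    rintro ω₂ ⟨p, hp, r, hr, hrp⟩ h
    exact h p hp ⟨r, hr, hrp⟩
  have h4 : (fun q : MarkedConfiguration d M × MarkedConfiguration d M =>
      MarkedConfiguration.superpose q.1 q.2) ⁻¹' voidEvent A =ᵐ[P.prod Q]
        (voidEvent A ×ˢ voidEvent A : Set _) := by
    refine Filter.eventuallyEq_set.mpr ?_
    filter_upwards [measure_eq_zero_iff_ae_notMem.mp h3] with q hq
    constructor
    · intro h
      refine ⟨mem_voidEvent.mpr fun p hp => mem_voidEvent.mp h p (Or.inl hp),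
        mem_voidEvent.mpr fun p hp => mem_voidEvent.mp h p (Or.inr ⟨hp, ?_⟩)⟩
      rintro ⟨r, hr, hrp⟩
      exact hq ⟨r, hr, p, hp, hrp.symm⟩
    · rintro ⟨h1, h2⟩
      refine mem_voidEvent.mpr ?_
      rintro p (hp | ⟨hp, -⟩)
      · exact mem_voidEvent.mp h1 p hp
      · exact mem_voidEvent.mp h2 p hp
  rw [map_measureReal_apply measurable_superpose (measurableSet_voidEvent hA.measurableSet),
    measureReal_congr h4, measureReal_prod_prod, hP.real_voidEvent A hA, hQ.real_voidEvent A hA,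
    ← Real.exp_add, NNReal.coe_add]
  congr 1
  ring

/-- The probability of an increasing event is a nondecreasing function of the intensity. -/
lemma HasPoissonVoidProbabilities.measure_le_of_lt [Nontrivial 𝔼[d]] (hd : d ≠ 0)
    {P Q : Measure (MarkedConfiguration d M)} {lam lam' : ℝ≥0} {ν : Measure M}
    [IsProbabilityMeasure ν] (hP : HasPoissonVoidProbabilities P lam ν)
    (hQ : HasPoissonVoidProbabilities Q lam' ν) (hlam : 0 < lam) (hlt : lam < lam')
    {T : Set (MarkedConfiguration d M)} (hT : MeasurableSet T)
    (hmono : ∀ ω ω' : MarkedConfiguration d M, ω.carrier ⊆ ω'.carrier → ω ∈ T → ω' ∈ T) :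
    P T ≤ Q T := by
  obtain ⟨P', hP'⟩ := hP.exists_intensity hd hlam (tsub_pos_of_lt hlt)
  have := hP.isProbabilityMeasure
  have := hP'.isProbabilityMeasure
  have h := hP.superpose hP'
  rw [add_tsub_cancel_of_le hlt.le] at h
  rw [hQ.unique h, Measure.map_apply measurable_superpose hT]
  calc P T = P.prod P' (T ×ˢ Set.univ) := by simp
    _ ≤ _ := measure_mono fun q hq => hmono q.1 _ Set.subset_union_left hq.1

end MarkedConfiguration

namespace MarkedConfiguration

variable {d : ℕ} {M : Type*}

/-! ### Percolation as an event -/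

/-- Two marked points of a configuration are linked if they are equal or joined by an edge. -/
def Linked (h : StructuralFunction M) (ω : MarkedConfiguration d M) (p q : 𝔼[d] × M) : Prop :=
  p ∈ ω.carrier ∧ q ∈ ω.carrier ∧ dist p.1 q.1 ≤ h.toFun p.2 q.2

lemma Linked.symm {h : StructuralFunction M} {ω : MarkedConfiguration d M} {p q : 𝔼[d] × M}
    (hpq : Linked h ω p q) : Linked h ω q p :=
  ⟨hpq.2.1, hpq.1, by rw [dist_comm, h.symm]; exact hpq.2.2⟩

lemma Linked.mono {h : StructuralFunction M} {ω ω' : MarkedConfiguration d M}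
    (hω : ω.carrier ⊆ ω'.carrier) {p q : 𝔼[d] × M} (hpq : Linked h ω p q) : Linked h ω' p q :=
  ⟨hω hpq.1, hω hpq.2.1, hpq.2.2⟩

open Relation in
/-- Percolation in terms of paths of marked points. -/
lemma percolates_iff (h : StructuralFunction M) (ω : MarkedConfiguration d M) :
    Percolates (booleanGraph h ω) ↔
      ∃ p ∈ ω.carrier, ∀ L : ℕ, ∃ q, ReflTransGen (Linked h ω) p q ∧ L < ‖q.1‖ := by
  constructor
  · rintro ⟨C, hC⟩
    induction C using SimpleGraph.ConnectedComponent.ind with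
    | h v =>
      obtain ⟨p, hp, hpv⟩ := v.2
      refine ⟨p, hp, fun L => ?_⟩
      have hreach : ∀ w, (booleanGraph h ω).Reachable v w →
          ∃ q, q.1 = w.1 ∧ ReflTransGen (Linked h ω) p q := by
        intro w hw
        rw [SimpleGraph.reachable_iff_reflTransGen] at hw
        induction hw with
        | refl => exact ⟨p, hpv, .refl⟩
        | @tail b c _ hbc ih =>
          obtain ⟨q, hqb, hpq⟩ := ih
          obtain ⟨-, a, a', ha, ha', hd⟩ := hbc
          refine ⟨(c.1, a'), rfl, hpq.tail ?_⟩
          have hq : q ∈ ω.carrier := by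
            rcases ReflTransGen.cases_tail hpq with rfl | ⟨_, -, h1⟩
            exacts [hp, h1.2.1]
          obtain ⟨x, e⟩ := q
          obtain rfl : x = b.1 := hqb
          obtain rfl := ω.mark_unique _ _ _ hq ha
          exact ⟨ha, ha', hd⟩
      by_contra! hL
      refine hC (isBounded_iff_forall_norm_le.mpr ⟨L, ?_⟩)
      rintro _ ⟨w, hw, rfl⟩
      have hw' : (booleanGraph h ω).Reachable v w :=
        (SimpleGraph.ConnectedComponent.exact hw).symm
      obtain ⟨q, hqw, hq⟩ := hreach w hw'
      rw [← hqw]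
      exact hL q hq
  · rintro ⟨p, hp, hL⟩
    refine ⟨(booleanGraph h ω).connectedComponentMk ⟨p.1, p, hp, rfl⟩, fun hb => ?_⟩
    have hreach : ∀ q, ReflTransGen (Linked h ω) p q → ∃ hq : q.1 ∈ ω.points,
        (booleanGraph h ω).Reachable ⟨p.1, p, hp, rfl⟩ ⟨q.1, hq⟩ := by
      intro q hq
      induction hq with
      | refl => exact ⟨⟨p, hp, rfl⟩, .rfl⟩
      | @tail b c _ hbc ih =>
        obtain ⟨hb', hr⟩ := ih
        refine ⟨⟨c, hbc.2.1, rfl⟩, hr.trans ?_⟩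
        by_cases hne : b.1 = c.1
        · simp only [hne]
          exact .rfl
        · exact SimpleGraph.Adj.reachable ⟨fun h' => hne (congrArg Subtype.val h'), b.2, c.2,
            hbc.1, hbc.2.1, hbc.2.2⟩
    obtain ⟨R, hR⟩ := isBounded_iff_forall_norm_le.mp hb
    obtain ⟨n, hn⟩ := exists_nat_ge R
    obtain ⟨q, hq, hqn⟩ := hL n
    obtain ⟨hq', hr⟩ := hreach q hq
    have := hR q.1 ⟨⟨q.1, hq'⟩, SimpleGraph.ConnectedComponent.sound hr.symm, rfl⟩
    linarith

lemma percolates_mono (h : StructuralFunction M) {ω ω' : MarkedConfiguration d M}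
    (hω : ω.carrier ⊆ ω'.carrier) (hp : Percolates (booleanGraph h ω)) :
    Percolates (booleanGraph h ω') := by
  rw [percolates_iff] at hp ⊢
  obtain ⟨p, hp, hL⟩ := hp
  refine ⟨p, hω hp, fun L => ?_⟩
  obtain ⟨q, hq, hqL⟩ := hL L
  exact ⟨q, Relation.ReflTransGen.mono (fun _ _ => Linked.mono hω) _ _ hq, hqL⟩

lemma percolates_congr {h h' : StructuralFunction M} {ω : MarkedConfiguration d M}
    (hω : ∀ p ∈ ω.carrier, ∀ q ∈ ω.carrier, h.toFun p.2 q.2 = h'.toFun p.2 q.2) :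
    Percolates (booleanGraph h ω) ↔ Percolates (booleanGraph h' ω) := by
  have : Linked h ω = Linked h' ω := by
    ext p q
    constructor
    · rintro ⟨hp, hq, hd⟩
      exact ⟨hp, hq, by rwa [← hω p hp q hq]⟩
    · rintro ⟨hp, hq, hd⟩
      exact ⟨hp, hq, by rwa [hω p hp q hq]⟩
  rw [percolates_iff, percolates_iff, this]

/-- There is a path with `m` steps from `p` to a point whose distance from the origin is larger
than `L`. -/
def ReachesFar (h : StructuralFunction M) (L : ℕ) :
    ℕ → MarkedConfiguration d M → 𝔼[d] × M → Prop
  | 0, _, p => L < ‖p.1‖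
  | m + 1, ω, p => ∃ q ∈ ω.carrier, dist p.1 q.1 ≤ h.toFun p.2 q.2 ∧ ReachesFar h L m ω q

open Relation in
lemma exists_reachesFar_iff (h : StructuralFunction M) (L : ℕ) (ω : MarkedConfiguration d M)
    {p : 𝔼[d] × M} (hp : p ∈ ω.carrier) :
    (∃ m, ReachesFar h L m ω p) ↔ ∃ q, ReflTransGen (Linked h ω) p q ∧ L < ‖q.1‖ := by
  constructor
  · rintro ⟨m, hm⟩
    induction m generalizing p with
    | zero => exact ⟨p, .refl, hm⟩
    | succ m ih =>
      obtain ⟨q, hq, hd, hm⟩ := hm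
      obtain ⟨r, hr, hrL⟩ := ih hq hm
      exact ⟨r, .head ⟨hp, hq, hd⟩ hr, hrL⟩
  · rintro ⟨q, hq, hqL⟩
    induction hq using ReflTransGen.head_induction_on with
    | refl => exact ⟨0, hqL⟩
    | @head b c hbc _ ih =>
      obtain ⟨m, hm⟩ := ih hbc.2.1
      exact ⟨m + 1, c, hbc.2.1, hbc.2.2, hm⟩

/-- The configuration without its points in the closed ball of radius `n` about the origin. -/
def outside (n : ℕ) (ω : MarkedConfiguration d M) : MarkedConfiguration d M where
  carrier := {p | p ∈ ω.carrier ∧ n < ‖p.1‖}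
  mark_unique x a b ha hb := ω.mark_unique x a b ha.1 hb.1
  locally_finite B hB := by
    refine (ω.locally_finite B hB).subset ?_
    rintro _ ⟨⟨p, hp, rfl⟩, hpB⟩
    exact ⟨⟨p, hp.1, rfl⟩, hpB⟩

open Relation in
lemma reflTransGen_linked_symm {h : StructuralFunction M} {ω : MarkedConfiguration d M}
    {p q : 𝔼[d] × M} (hpq : ReflTransGen (Linked h ω) p q) : ReflTransGen (Linked h ω) q p := by
  induction hpq with
  | refl => exact .refl
  | tail _ hbc ih => exact .head hbc.symm ih

open Relation in
/-- A path that starts outside a ball either avoids the ball or passes close to it before it enters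
it. -/
lemma reflTransGen_outside_or (h : StructuralFunction M) {R : ℝ} (hR : ∀ a b, h.toFun a b ≤ R)
    (n : ℕ) (ω : MarkedConfiguration d M) {q p : 𝔼[d] × M} (hq : q ∈ ω.carrier)
    (hqn : n < ‖q.1‖) (hqp : ReflTransGen (Linked h ω) q p) :
    (p ∈ (outside n ω).carrier ∧ ReflTransGen (Linked h (outside n ω)) q p) ∨
      ∃ z ∈ (outside n ω).carrier, ‖z.1‖ ≤ n + R ∧
        ReflTransGen (Linked h (outside n ω)) q z := by
  induction hqp with
  | refl => exact Or.inl ⟨⟨hq, hqn⟩, .refl⟩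
  | @tail b c _ hbc ih =>
    rcases ih with ⟨hb, hqb⟩ | h'
    · rcases lt_or_ge (n : ℝ) ‖c.1‖ with hc | hc
      · exact Or.inl ⟨⟨hbc.2.1, hc⟩, hqb.tail ⟨hb, ⟨hbc.2.1, hc⟩, hbc.2.2⟩⟩
      · refine Or.inr ⟨b, hb, ?_, hqb⟩
        have h1 := hbc.2.2.trans (hR _ _)
        have h2 := norm_le_norm_add_norm_sub' b.1 c.1
        rw [← dist_eq_norm] at h2
        linarith
    · exact Or.inr h'

open Relation in
/-- If edges have bounded lengths, then percolation is not affected by the removal of the points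
in a ball: a cluster is split into pieces that pass close to the ball, and these are finitely
many. -/
lemma percolates_outside_iff (h : StructuralFunction M) {R : ℝ} (hR : ∀ a b, h.toFun a b ≤ R)
    (n : ℕ) (ω : MarkedConfiguration d M) :
    Percolates (booleanGraph h (outside n ω)) ↔ Percolates (booleanGraph h ω) := by
  refine ⟨percolates_mono h fun p hp => hp.1, fun hperc => ?_⟩
  by_contra hcon
  rw [percolates_iff] at hperc hcon
  push Not at hcon
  obtain ⟨p, hp, hL⟩ := hperc
  choose! K hK using hcon
  have hfin : (insert p {z | z ∈ (outside n ω).carrier ∧ ‖z.1‖ ≤ n + R}).Finite := by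
    refine Set.Finite.insert _ (((outside n ω).finite_carrier_inter
      (Metric.isBounded_closedBall (x := 0) (r := n + R)) Set.univ).subset ?_)
    rintro z ⟨hz, hzn⟩
    exact ⟨hz, by simpa using hzn, trivial⟩
  obtain ⟨N, hN⟩ := (hfin.image K).bddAbove
  obtain ⟨q, hpq, hqL⟩ := hL (max N n)
  rw [Nat.cast_max, max_lt_iff] at hqL
  have hq : q ∈ ω.carrier := by
    rcases ReflTransGen.cases_tail hpq with rfl | ⟨_, -, h1⟩
    exacts [hp, h1.2.1]
  have key : ∀ z ∈ (outside n ω).carrier,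
      z ∈ insert p {z | z ∈ (outside n ω).carrier ∧ ‖z.1‖ ≤ n + R} →
      ReflTransGen (Linked h (outside n ω)) q z → False := by
    intro z hz hz' hqz
    have h1 := hK z hz q (reflTransGen_linked_symm hqz)
    have h2 : (K z : ℝ) ≤ N := by exact_mod_cast hN ⟨z, hz', rfl⟩
    linarith
  rcases reflTransGen_outside_or h hR n ω hq hqL.2
    (reflTransGen_linked_symm hpq) with ⟨hp', h1⟩ | ⟨z, hz, hzn, h1⟩
  · exact key p hp' (Set.mem_insert _ _) h1
  · exact key z hz (Set.mem_insert_of_mem _ ⟨hz, hzn⟩) h1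

lemma outside_preimage_voidEvent (n : ℕ) (A : Set (𝔼[d] × M)) :
    outside n ⁻¹' voidEvent A =
      (voidEvent (A ∩ (Metric.closedBall 0 n)ᶜ ×ˢ Set.univ) : Set (MarkedConfiguration d M)) := by
  ext ω
  simp only [Set.mem_preimage, mem_voidEvent, outside, Set.mem_ofPred_eq, Set.mem_inter_iff,
    Set.mem_prod, Set.mem_compl_iff, mem_closedBall_zero_iff, Set.mem_univ, and_true, not_le]
  grind

variable [MeasurableSpace M] [MeasurableSingletonClass M]

lemma measurableSet_reachesFar {h : StructuralFunction M}
    (hh : Measurable fun p : M × M => h.toFun p.1 p.2) (L m : ℕ) :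
    MeasurableSet {y : MarkedConfiguration d M × (𝔼[d] × M) | ReachesFar h L m y.1 y.2} := by
  induction m with
  | zero => exact measurableSet_lt (by fun_prop) (by fun_prop)
  | succ m ih =>
    refine measurableSet_exists_mem_carrier measurable_fst
      (C := fun (y : MarkedConfiguration d M × (𝔼[d] × M)) q =>
        dist y.2.1 q.1 ≤ h.toFun y.2.2 q.2 ∧ ReachesFar h L m y.1 q) (.inter ?_ ?_)
    · refine measurableSet_le (by fun_prop) (hh.comp (f := fun y : (MarkedConfiguration d M ×
        (𝔼[d] × M)) × (𝔼[d] × M) => (y.1.2.2, y.2.2)) ?_)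
      fun_prop
    · exact ((measurable_fst.comp measurable_fst).prodMk measurable_snd) ih

lemma measurableSet_percolates {h : StructuralFunction M}
    (hh : Measurable fun p : M × M => h.toFun p.1 p.2) :
    MeasurableSet {ω : MarkedConfiguration d M | Percolates (booleanGraph h ω)} := by
  have h1 : {ω : MarkedConfiguration d M | Percolates (booleanGraph h ω)} =
      {ω | ∃ p ∈ ω.carrier, ∀ L, ∃ m, ReachesFar h L m ω p} := by
    ext ω
    rw [Set.mem_ofPred_eq, percolates_iff]
    refine exists_congr fun p => and_congr_right fun hp => forall_congr' fun L => ?_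
    rw [exists_reachesFar_iff h L ω hp]
  rw [h1]
  refine measurableSet_exists_mem_carrier measurable_id
    (C := fun ω p => ∀ L, ∃ m, ReachesFar h L m ω p) ?_
  simp_rw [Set.ofPred_forall, Set.ofPred_exists]
  exact MeasurableSet.iInter fun L => MeasurableSet.iUnion fun m => measurableSet_reachesFar hh L m

/-! ### Zero-one law -/

lemma measurable_outside (n : ℕ) :
    Measurable (outside n : MarkedConfiguration d M → MarkedConfiguration d M) := by
  refine measurable_of_voidEvent fun A hA => ?_
  rw [outside_preimage_voidEvent]
  exact measurableSet_voidEvent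
    (hA.inter_prod_univ Metric.isClosed_closedBall.measurableSet.compl).measurableSet

/-- The zero-one law of Kolmogorov: an event that is not affected by the removal of the points in
balls is independent of the configuration in each ball, hence of itself. -/
lemma HasPoissonVoidProbabilities.measure_eq_zero_or_one {P : Measure (MarkedConfiguration d M)}
    {lam : ℝ≥0} {ν : Measure M} [IsProbabilityMeasure ν]
    (hP : HasPoissonVoidProbabilities P lam ν) {T : Set (MarkedConfiguration d M)}
    (hT : MeasurableSet T) (hinv : ∀ n, outside n ⁻¹' T = T) : P T = 0 ∨ P T = 1 := by
  have := hP.isProbabilityMeasure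
  have hle : ∀ A : Set (𝔼[d] × M), IsSimpleRegion A →
      MeasurableSpace.generateFrom {(voidEvent A : Set (MarkedConfiguration d M))} ≤
        instMeasurableSpace := by
    intro A hA
    refine MeasurableSpace.generateFrom_le ?_
    rintro _ rfl
    exact measurableSet_voidEvent hA.measurableSet
  have h1 : ∀ A : Set (𝔼[d] × M), IsSimpleRegion A →
      P (T ∩ voidEvent A) = P T * P (voidEvent A) := by
    intro A hA
    obtain ⟨n, hn⟩ := hA.exists_subset_prod_univ
    have hgen : MeasurableSpace.comap (outside n) (instMeasurableSpace :
        MeasurableSpace (MarkedConfiguration d M)) = MeasurableSpace.generateFrom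
          ((outside n ⁻¹' ·) '' {V | ∃ A, IsSimpleRegion A ∧ V = voidEvent A}) := by
      rw [instMeasurableSpace_eq_generateFrom, MeasurableSpace.comap_generateFrom]
    have hind : Indep (MeasurableSpace.comap (outside n) instMeasurableSpace)
        (MeasurableSpace.generateFrom {(voidEvent A : Set (MarkedConfiguration d M))}) P := by
      refine IndepSets.indep (measurable_outside n).comap_le (hle A hA)
        ?_ (IsPiSystem.singleton _) hgen rfl ?_
      · rintro _ ⟨V, hV, rfl⟩ _ ⟨W, hW, rfl⟩ hne
        refine ⟨V ∩ W, isPiSystem_voidEvent V hV W hW ?_, rfl⟩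
        obtain ⟨ω, hω⟩ := hne
        exact ⟨_, hω⟩
      · rw [IndepSets_iff]
        rintro _ _ ⟨_, ⟨A', hA', rfl⟩, rfl⟩ rfl
        have hA'' := hA'.inter_prod_univ
          (Metric.isClosed_closedBall (x := (0 : 𝔼[d])) (ε := n)).measurableSet.compl
        beta_reduce
        rw [outside_preimage_voidEvent, voidEvent_inter, hP.measure_voidEvent (hA''.union hA),
          hP.measure_voidEvent hA'', hP.measure_voidEvent hA,
          ← ENNReal.ofReal_mul (Real.exp_pos _).le, ← Real.exp_add,
          measureReal_union ?_ hA.measurableSet (hA''.measure_ne_top ν) (hA.measure_ne_top ν)]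
        · congr 2
          ring
        · exact Set.disjoint_left.mpr fun p hp hpA => hp.2.1 (hn hpA).1
    rw [Indep_iff] at hind
    exact hind _ _ ⟨T, hT, hinv n⟩ (MeasurableSpace.measurableSet_generateFrom rfl)
  have h2 : Indep (MeasurableSpace.generateFrom {T}) instMeasurableSpace P := by
    refine IndepSets.indep (MeasurableSpace.generateFrom_le ?_) le_rfl (IsPiSystem.singleton _)
      isPiSystem_voidEvent rfl instMeasurableSpace_eq_generateFrom ?_
    · rintro _ rfl
      exact hT
    · rw [IndepSets_iff]
      rintro _ _ rfl ⟨A, hA, rfl⟩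
      exact h1 A hA
  rw [Indep_iff] at h2
  have h3 := h2 T T (MeasurableSpace.measurableSet_generateFrom rfl) hT
  rw [Set.inter_self] at h3
  by_cases h0 : P T = 0
  · exact Or.inl h0
  · right
    have h4 : P T * 1 = P T * P T := by rw [mul_one]; exact h3
    exact ((ENNReal.mul_right_inj h0 (measure_ne_top _ _)).mp h4).symm

end MarkedConfiguration

variable {d : ℕ}

/-! ### Cubes -/

/-- The index of the cube of side `s` that contains `x`. -/
noncomputable def cubeIndex (s : ℝ) (x : 𝔼[d]) : Fin d → ℤ := fun i => ⌊x i / s⌋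

/-- The half-open cube of side `s` with lower corner `s u`. -/
def cube (s : ℝ) (u : Fin d → ℤ) : Set 𝔼[d] := {x | cubeIndex s x = u}

lemma mem_cube_iff {s : ℝ} (hs : 0 < s) {u : Fin d → ℤ} {x : 𝔼[d]} :
    x ∈ cube s u ↔ ∀ i, u i * s ≤ x i ∧ x i < (u i + 1) * s := by
  simp only [cube, cubeIndex, Set.mem_ofPred_eq, funext_iff, Int.floor_eq_iff, le_div_iff₀ hs,
    div_lt_iff₀ hs]

lemma cube_eq_preimage_pi {s : ℝ} (hs : 0 < s) (u : Fin d → ℤ) :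
    cube s u = WithLp.ofLp ⁻¹' (Set.univ.pi fun i => Set.Ico (u i * s) ((u i + 1) * s)) := by
  ext x
  simp [mem_cube_iff hs]

lemma measurableSet_cube {s : ℝ} (hs : 0 < s) (u : Fin d → ℤ) : MeasurableSet (cube s u) := by
  rw [cube_eq_preimage_pi hs]
  exact (MeasurableSet.univ_pi fun _ => measurableSet_Ico).preimage (by fun_prop)

lemma volume_cube {s : ℝ} (hs : 0 < s) (u : Fin d → ℤ) :
    volume (cube s u) = ENNReal.ofReal (s ^ d) := by
  rw [cube_eq_preimage_pi hs, (PiLp.volume_preserving_ofLp (Fin d)).measure_preimage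
    (MeasurableSet.univ_pi fun _ => measurableSet_Ico).nullMeasurableSet, Real.volume_pi_Ico,
    ENNReal.ofReal_pow hs.le]
  simp only [add_mul, one_mul, add_sub_cancel_left, Finset.prod_const, Finset.card_univ,
    Fintype.card_fin]

lemma disjoint_cube {s : ℝ} {u v : Fin d → ℤ} (huv : u ≠ v) :
    Disjoint (cube s u) (cube s v) :=
  Set.disjoint_left.mpr fun _ hx hx' => huv (hx.symm.trans hx')

lemma dist_le_sum_abs (x y : 𝔼[d]) : dist x y ≤ ∑ i, |x i - y i| := by
  rw [EuclideanSpace.dist_eq, Real.sqrt_le_left (Finset.sum_nonneg fun i _ => abs_nonneg _)]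
  simp_rw [Real.dist_eq]
  exact Finset.sum_sq_le_sq_sum_of_nonneg fun i _ => abs_nonneg _

lemma dist_le_of_mem_cube {s : ℝ} (hs : 0 < s) {u v : Fin d → ℤ} (huv : ∀ i, |u i - v i| ≤ 1)
    {x y : 𝔼[d]} (hx : x ∈ cube s u) (hy : y ∈ cube s v) : dist x y ≤ d * (2 * s) := by
  rw [mem_cube_iff hs] at hx hy
  refine (dist_le_sum_abs x y).trans ?_
  calc ∑ i, |x i - y i| ≤ ∑ _i : Fin d, 2 * s := by
        refine Finset.sum_le_sum fun i _ => ?_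
        obtain ⟨h1, h2⟩ := hx i
        obtain ⟨h3, h4⟩ := hy i
        obtain ⟨h5, h6⟩ := abs_le.mp (huv i)
        have h5' : (-1 : ℝ) ≤ u i - v i := by exact_mod_cast h5
        have h6' : (u i - v i : ℝ) ≤ 1 := by exact_mod_cast h6
        rw [abs_le]
        constructor <;> nlinarith
    _ = d * (2 * s) := by simp

lemma isBounded_cube {s : ℝ} (hs : 0 < s) (u : Fin d → ℤ) : Bornology.IsBounded (cube s u) :=
  Metric.isBounded_iff.mpr ⟨_, fun _ hx _ hy => dist_le_of_mem_cube hs (fun i => by simp) hx hy⟩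

lemma abs_cubeIndex_sub_le {s : ℝ} (hs : 0 < s) {x y : 𝔼[d]} (hxy : dist x y ≤ s) (i : Fin d) :
    |cubeIndex s x i - cubeIndex s y i| ≤ 1 := by
  have h1 : |x i - y i| ≤ s := by
    rw [dist_eq_norm] at hxy
    exact (PiLp.norm_apply_le (x - y) i).trans hxy
  obtain ⟨h2, h3⟩ := abs_le.mp h1
  obtain ⟨h4, h5⟩ := (mem_cube_iff hs (u := cubeIndex s x)).mp rfl i
  obtain ⟨h6, h7⟩ := (mem_cube_iff hs (u := cubeIndex s y)).mp rfl i
  have h8 : (cubeIndex s x i : ℝ) < cubeIndex s y i + 2 := by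
    by_contra! h
    nlinarith
  have h9 : (cubeIndex s y i : ℝ) < cubeIndex s x i + 2 := by
    by_contra! h
    nlinarith
  have h8' : cubeIndex s x i < cubeIndex s y i + 2 := by exact_mod_cast h8
  have h9' : cubeIndex s y i < cubeIndex s x i + 2 := by exact_mod_cast h9
  rw [abs_le]
  omega

/-! ### Absence of percolation at small intensity -/

/-- The sequences of `n + 1` indices of cubes that start at `u` and in which consecutive indices
differ by at most one in each coordinate. -/
def pathsFrom : ℕ → (Fin d → ℤ) → Finset (List (Fin d → ℤ))
  | 0, u => {[u]}
  | n + 1, u => Finset.univ.biUnion fun δ : Fin d → Fin 3 =>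
      (pathsFrom n fun i => u i + (δ i - 1 : ℤ)).image (u :: ·)

lemma card_pathsFrom_le (n : ℕ) (u : Fin d → ℤ) : (pathsFrom n u).card ≤ (3 ^ d) ^ n := by
  induction n generalizing u with
  | zero => simp [pathsFrom]
  | succ n ih =>
    refine (Finset.card_biUnion_le_card_mul _ _ _ fun δ _ =>
      Finset.card_image_le.trans (ih _)).trans ?_
    simp [pow_succ, mul_comm]

lemma length_of_mem_pathsFrom {n : ℕ} {u : Fin d → ℤ} {l : List (Fin d → ℤ)}
    (hl : l ∈ pathsFrom n u) : l.length = n + 1 := by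
  induction n generalizing u l with
  | zero =>
    rw [pathsFrom, Finset.mem_singleton] at hl
    simp [hl]
  | succ n ih =>
    simp only [pathsFrom, Finset.mem_biUnion, Finset.mem_image] at hl
    obtain ⟨δ, -, l', hl', rfl⟩ := hl
    simp [ih hl']

/-- The graph on the occupied cubes in which cubes that touch are adjacent. -/
def occupiedGraph (occ : (Fin d → ℤ) → Prop) : SimpleGraph (Fin d → ℤ) where
  Adj u v := u ≠ v ∧ occ u ∧ occ v ∧ ∀ i, |u i - v i| ≤ 1
  symm := ⟨fun u v h => ⟨h.1.symm, h.2.2.1, h.2.1, fun i => by rw [abs_sub_comm]; exact h.2.2.2 i⟩⟩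
  loopless := ⟨fun u h => h.1 rfl⟩

lemma take_support_mem_pathsFrom {occ : (Fin d → ℤ) → Prop} {u v : Fin d → ℤ}
    (p : (occupiedGraph occ).Walk u v) (n : ℕ) (hn : n ≤ p.length) :
    p.support.take (n + 1) ∈ pathsFrom n u := by
  induction p generalizing n with
  | nil =>
    obtain rfl : n = 0 := by simpa using hn
    simp [pathsFrom]
  | @cons u v w huv p ih =>
    cases n with
    | zero => simp [pathsFrom]
    | succ n =>
      simp only [pathsFrom, Finset.mem_biUnion, Finset.mem_image, Finset.mem_univ, true_and]
      have h1 : ∀ i, 0 ≤ v i - u i + 1 ∧ v i - u i + 1 < 3 := fun i => by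
        have := abs_le.mp (huv.2.2.2 i)
        omega
      refine ⟨fun i => ⟨(v i - u i + 1).toNat, by have := h1 i; omega⟩, p.support.take (n + 1),
        ?_, by simp⟩
      convert ih n (by simpa using hn) using 2
      ext i
      have := h1 i
      push_cast
      rw [Int.toNat_of_nonneg this.1]
      ring

lemma abs_sub_le_length {occ : (Fin d → ℤ) → Prop} {u v : Fin d → ℤ}
    (p : (occupiedGraph occ).Walk u v) (i : Fin d) : |u i - v i| ≤ p.length := by
  induction p with
  | nil => simp
  | @cons u v w huv p ih =>
    have h1 := huv.2.2.2 i
    have h2 := abs_sub_le (u i) (v i) (w i)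
    simp only [SimpleGraph.Walk.length_cons, Nat.cast_add, Nat.cast_one]
    linarith

lemma occ_of_mem_support {occ : (Fin d → ℤ) → Prop} {u v : Fin d → ℤ} (hu : occ u)
    (p : (occupiedGraph occ).Walk u v) : ∀ w ∈ p.support, occ w := by
  induction p with
  | nil => simpa using hu
  | @cons u v w huv p ih =>
    intro x hx
    rw [SimpleGraph.Walk.support_cons, List.mem_cons] at hx
    rcases hx with rfl | hx
    · exact hu
    · exact ih huv.2.2.1 x hx

namespace MarkedConfiguration

variable {M : Type*}

open Relation in
/-- If the edges have length at most `s`, then an unbounded cluster visits arbitrarily long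
self-avoiding paths of occupied cubes of side `s`. -/
lemma exists_path_of_percolates {h : StructuralFunction M} {s : ℝ} (hs : 0 < s)
    (hR : ∀ a b, h.toFun a b ≤ s) {ω : MarkedConfiguration d M}
    (hω : Percolates (booleanGraph h ω)) :
    ∃ u : Fin d → ℤ, ∀ n, ∃ l ∈ pathsFrom n u, l.Nodup ∧
      ∀ v ∈ l, (ω.points ∩ cube s v).Nonempty := by
  rw [percolates_iff] at hω
  obtain ⟨p, hp, hL⟩ := hω
  refine ⟨cubeIndex s p.1, fun n => ?_⟩
  set u := cubeIndex s p.1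
  let occ : (Fin d → ℤ) → Prop := fun v => (ω.points ∩ cube s v).Nonempty
  have hocc : ∀ q ∈ ω.carrier, occ (cubeIndex s q.1) := fun q hq => ⟨q.1, ⟨q, hq, rfl⟩, rfl⟩
  have hreach : ∀ q, ReflTransGen (Linked h ω) p q →
      (occupiedGraph occ).Reachable u (cubeIndex s q.1) := by
    intro q hq
    induction hq with
    | refl => exact .rfl
    | @tail b c _ hbc ih =>
      refine ih.trans ?_
      by_cases hne : cubeIndex s b.1 = cubeIndex s c.1
      · rw [hne]
      · exact SimpleGraph.Adj.reachable ⟨hne, hocc b hbc.1, hocc c hbc.2.1,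
          abs_cubeIndex_sub_le hs (hbc.2.2.trans (hR _ _))⟩
  have hbdd : Bornology.IsBounded
      (⋃ v ∈ Set.Icc (fun i => u i - n) (fun i => u i + n), cube s v) :=
    (Bornology.isBounded_biUnion (Set.finite_Icc _ _)).mpr fun v _ => isBounded_cube hs v
  obtain ⟨K, hK⟩ := isBounded_iff_forall_norm_le.mp hbdd
  obtain ⟨N, hN⟩ := exists_nat_ge K
  obtain ⟨q, hpq, hqN⟩ := hL N
  obtain ⟨w, hw⟩ := (hreach q hpq).exists_isPath
  have hn : n ≤ w.length := by
    by_contra! hlt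
    refine absurd (hK q.1 (Set.mem_biUnion (x := cubeIndex s q.1) ?_ rfl)) (by linarith)
    constructor <;> intro i
    all_goals
      have := abs_le.mp (abs_sub_le_length w i)
      beta_reduce
      omega
  refine ⟨_, take_support_mem_pathsFrom w n hn, hw.support_nodup.sublist (List.take_sublist _ _),
    fun v hv => occ_of_mem_support (hocc p hp) w v (List.mem_of_mem_take hv)⟩

end MarkedConfiguration

open MarkedConfiguration

lemma poissonMeasure_compl_zero_le (r : ℝ≥0) : poissonMeasure r {0}ᶜ ≤ r := by
  rw [prob_compl_eq_one_sub (measurableSet_singleton 0), poissonMeasure_singleton]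
  simp only [pow_zero, mul_one, Nat.factorial_zero, Nat.cast_one, div_one]
  rw [tsub_le_iff_right, ← ENNReal.ofReal_one, ← ENNReal.ofReal_coe_nnreal,
    ← ENNReal.ofReal_add r.coe_nonneg (Real.exp_pos _).le]
  refine ENNReal.ofReal_le_ofReal ?_
  have := Real.add_one_le_exp (-(r : ℝ))
  linarith

/-- The probability that each of the given distinct cubes contains a point. -/
lemma IsPoissonPointProcess.measure_forall_nonempty_le {Ω : Type*} [MeasurableSpace Ω]
    {P : Measure Ω} {ξ : Ω → Set 𝔼[d]} {lam : ℝ≥0} (hP : IsPoissonPointProcess P ξ lam) {s : ℝ}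
    (hs : 0 < s) {l : List (Fin d → ℤ)} (hl : l.Nodup) :
    P {ω | ∀ v ∈ l, (ξ ω ∩ cube s v).Nonempty} ≤
      (lam * (s ^ d).toNNReal : ℝ≥0) ^ l.length := by
  have hind := hP.indep_count l.length (fun i => cube s (l.get i)) (fun i => isBounded_cube hs _)
    (fun i => measurableSet_cube hs _)
    fun i j hij => disjoint_cube fun h => hij (List.nodup_iff_injective_get.mp hl h)
  have h1 := hind.measure_inter_preimage_eq_mul Finset.univ (sets := fun _ => {0}ᶜ)
    fun i _ => .of_discrete
  have h2 : {ω | ∀ v ∈ l, (ξ ω ∩ cube s v).Nonempty} ⊆ ⋂ i ∈ (Finset.univ : Finset (Fin l.length)),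
      (fun ω => (ξ ω ∩ cube s (l.get i)).ncard) ⁻¹' {0}ᶜ := by
    intro ω hω
    simp only [Set.mem_iInter]
    intro i _ h0
    have hne := hω (l.get i) (List.get_mem l i)
    have h0' : (ξ ω ∩ cube s (l.get i)).ncard = 0 := h0
    rw [Set.ncard_eq_zero (hP.locally_finite ω _ (isBounded_cube hs _))] at h0'
    exact hne.ne_empty h0'
  refine (measure_mono h2).trans ?_
  rw [h1]
  calc _ ≤ ∏ _i : Fin l.length, ((lam * (s ^ d).toNNReal : ℝ≥0) : ℝ≥0∞) := by
        refine Finset.prod_le_prod' fun i _ => ?_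
        have hlaw := hP.hasLaw_count _ (isBounded_cube hs (l.get i)) (measurableSet_cube hs _)
        rw [← Measure.map_apply_of_aemeasurable hlaw.aemeasurable .of_discrete, hlaw.map_eq,
          volume_cube hs]
        exact poissonMeasure_compl_zero_le _
    _ = _ := by simp

/-- If the edges have bounded length and the intensity is small, then there is almost surely no
percolation, since the expected number of occupied self-avoiding paths of cubes from a given cube
tends to zero with the length. -/
lemma IsPoissonPointProcess.ae_not_percolates {M : Type*} [MeasurableSpace M]
    {P : Measure (MarkedConfiguration d M)} {lam : ℝ≥0} (hP : IsPoissonPointProcess P points lam)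
    {h : StructuralFunction M} {s : ℝ} (hs : 0 < s) (hR : ∀ a b, h.toFun a b ≤ s)
    (hlam : 3 ^ d * (lam * (s ^ d).toNNReal) ≤ 1 / 2) :
    ∀ᵐ ω ∂P, ¬ Percolates (booleanGraph h ω) := by
  set r : ℝ≥0 := lam * (s ^ d).toNNReal
  have h1 : ∀ (u : Fin d → ℤ) (n : ℕ), P {ω | ∃ l ∈ pathsFrom n u, l.Nodup ∧
      ∀ v ∈ l, (ω.points ∩ cube s v).Nonempty} ≤ ((1 / 2 : ℝ≥0) : ℝ≥0∞) ^ n := by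
    intro u n
    have h2 : {ω : MarkedConfiguration d M | ∃ l ∈ pathsFrom n u, l.Nodup ∧
        ∀ v ∈ l, (ω.points ∩ cube s v).Nonempty} ⊆ ⋃ l ∈ (pathsFrom n u).filter List.Nodup,
          {ω | ∀ v ∈ l, (ω.points ∩ cube s v).Nonempty} := by
      rintro ω ⟨l, hl, hnd, hω⟩
      exact Set.mem_biUnion (Finset.mem_filter.mpr ⟨hl, hnd⟩) hω
    have hr : r ≤ 1 := by
      have h3 : (1 : ℝ≥0) ≤ 3 ^ d := one_le_pow₀ (by norm_num)
      calc r = 1 * r := (one_mul r).symm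
        _ ≤ 3 ^ d * r := by gcongr
        _ ≤ 1 / 2 := hlam
        _ ≤ 1 := by norm_num
    calc P _ ≤ ∑ l ∈ (pathsFrom n u).filter List.Nodup,
          P {ω | ∀ v ∈ l, (ω.points ∩ cube s v).Nonempty} :=
          (measure_mono h2).trans (measure_biUnion_finset_le _ _)
      _ ≤ ∑ l ∈ (pathsFrom n u).filter List.Nodup, (r : ℝ≥0∞) ^ n := by
          refine Finset.sum_le_sum fun l hl => ?_
          obtain ⟨hl, hnd⟩ := Finset.mem_filter.mp hl
          refine (hP.measure_forall_nonempty_le hs hnd).trans ?_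
          rw [length_of_mem_pathsFrom hl]
          exact pow_le_pow_right_of_le_one' (by exact_mod_cast hr) (Nat.le_succ n)
      _ ≤ ((3 ^ d) ^ n : ℕ) * (r : ℝ≥0∞) ^ n := by
          rw [Finset.sum_const, nsmul_eq_mul]
          gcongr
          exact (Finset.card_filter_le _ _).trans (card_pathsFrom_le n u)
      _ = ((3 ^ d * r : ℝ≥0) : ℝ≥0∞) ^ n := by
          push_cast
          rw [mul_pow]
      _ ≤ _ := by gcongr
  have h2 : ∀ u : Fin d → ℤ, P {ω | ∀ n, ∃ l ∈ pathsFrom n u, l.Nodup ∧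
      ∀ v ∈ l, (ω.points ∩ cube s v).Nonempty} = 0 := by
    intro u
    have h3 : Filter.Tendsto (fun n : ℕ => ((1 / 2 : ℝ≥0) : ℝ≥0∞) ^ n) Filter.atTop (nhds 0) :=
      ENNReal.tendsto_pow_atTop_nhds_zero_of_lt_one (by norm_num)
    exact le_antisymm (ge_of_tendsto' h3 fun n =>
      (measure_mono (Set.ofPred_subset_ofPred.mpr fun ω hω => hω n)).trans (h1 u n)) zero_le
  have h3 := measure_iUnion_null h2
  refine measure_mono_null (fun ω hω => ?_) h3
  rw [Set.mem_compl_iff, Set.mem_ofPred_eq, not_not] at hω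
  obtain ⟨u, hu⟩ := exists_path_of_percolates hs hR hω
  exact Set.mem_iUnion.mpr ⟨u, hu⟩

/-! ### Renormalization of connectivity on the quadrant -/

/-- A notion of connectivity for a random set of open sites of the quadrant `ℕ × ℕ`: a symmetric
and transitive relation such that neighboring open sites are related. The open sites are those
that are related to themselves. -/
structure IsConnectivity (S : ℕ × ℕ → ℕ × ℕ → Prop) : Prop where
  symm : ∀ {v w}, S v w → S w v
  trans : ∀ {u v w}, S u v → S v w → S u w
  right : ∀ {x y}, S (x, y) (x, y) → S (x + 1, y) (x + 1, y) → S (x, y) (x + 1, y)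
  up : ∀ {x y}, S (x, y) (x, y) → S (x, y + 1) (x, y + 1) → S (x, y) (x, y + 1)

/-- The nine sites of the block `v`. -/
def subsite (v : ℕ × ℕ) (δ : Fin 3 × Fin 3) : ℕ × ℕ := (3 * v.1 + δ.1, 3 * v.2 + δ.2)

/-- A block is good if at most one of its nine sites is not open. -/
def GoodBlock (S : ℕ × ℕ → ℕ × ℕ → Prop) (v : ℕ × ℕ) : Prop :=
  ∀ δ ε, ¬ S (subsite v δ) (subsite v δ) → ¬ S (subsite v ε) (subsite v ε) → δ = ε

/-- The connectivity of blocks: two good blocks are related if all open sites of the one are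
related to all open sites of the other. -/
def coarsen (S : ℕ × ℕ → ℕ × ℕ → Prop) (v w : ℕ × ℕ) : Prop :=
  GoodBlock S v ∧ GoodBlock S w ∧ ∀ δ ε, S (subsite v δ) (subsite v δ) →
    S (subsite w ε) (subsite w ε) → S (subsite v δ) (subsite w ε)

namespace IsConnectivity

variable {S : ℕ × ℕ → ℕ × ℕ → Prop}

/-- Three open sites in a line are related. -/
lemma line (hS : IsConnectivity S) {f : Fin 3 → ℕ × ℕ} (h0 : S (f 0) (f 1)) (h1 : S (f 1) (f 2))
    (i j : Fin 3) : S (f i) (f j) := by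
  have h : ∀ i, S (f 1) (f i) := by
    intro i
    fin_cases i
    · exact hS.symm h0
    · exact hS.trans (hS.symm h0) h0
    · exact h1
  exact hS.trans (hS.symm (h i)) (h j)

lemma row (hS : IsConnectivity S) {v : ℕ × ℕ} {y : Fin 3}
    (hy : ∀ x, S (subsite v (x, y)) (subsite v (x, y))) (i j : Fin 3) :
    S (subsite v (i, y)) (subsite v (j, y)) :=
  hS.line (f := fun i => subsite v (i, y)) (hS.right (hy 0) (hy 1)) (hS.right (hy 1) (hy 2)) i j

lemma column (hS : IsConnectivity S) {v : ℕ × ℕ} {x : Fin 3}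
    (hx : ∀ y, S (subsite v (x, y)) (subsite v (x, y))) (i j : Fin 3) :
    S (subsite v (x, i)) (subsite v (x, j)) :=
  hS.line (f := fun i => subsite v (x, i)) (hS.up (hx 0) (hx 1)) (hS.up (hx 1) (hx 2)) i j

/-- The open sites of a good block are related: there are a full row and a full column without
the bad site, and every open site lies in a full row or in a full column. -/
lemma of_goodBlock (hS : IsConnectivity S) {v : ℕ × ℕ} (hv : GoodBlock S v) {δ ε : Fin 3 × Fin 3}
    (hδ : S (subsite v δ) (subsite v δ)) (hε : S (subsite v ε) (subsite v ε)) :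
    S (subsite v δ) (subsite v ε) := by
  obtain ⟨β, hβ⟩ : ∃ β, ∀ δ, δ ≠ β ∨ (∀ ε, S (subsite v ε) (subsite v ε)) →
      S (subsite v δ) (subsite v δ) := by
    by_cases h : ∃ β, ¬ S (subsite v β) (subsite v β)
    · obtain ⟨β, hβ⟩ := h
      refine ⟨β, fun δ hδ => ?_⟩
      rcases hδ with hδ | hδ
      · by_contra hcon
        exact hδ (hv _ _ hcon hβ)
      · exact hδ δ
    · push Not at h
      exact ⟨0, fun δ _ => h δ⟩
  have hrow : ∀ y, y ≠ β.2 → ∀ x, S (subsite v (x, y)) (subsite v (x, y)) := fun y hy x =>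
    hβ _ (Or.inl fun h => hy (congrArg Prod.snd h))
  have hcol : ∀ x, x ≠ β.1 → ∀ y, S (subsite v (x, y)) (subsite v (x, y)) := fun x hx y =>
    hβ _ (Or.inl fun h => hx (congrArg Prod.fst h))
  have hne : ∀ i : Fin 3, i + 1 ≠ i := by decide
  -- The row and the column after those of `β`, modulo 3, are full. They meet in the hub.
  have hub : ∀ δ, S (subsite v δ) (subsite v δ) →
      S (subsite v (β.1 + 1, β.2 + 1)) (subsite v δ) := by
    rintro ⟨x, y⟩ hxy
    by_cases hx : x = β.1
    · have hy : ∀ x, S (subsite v (x, y)) (subsite v (x, y)) := by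
        by_cases hy : y = β.2
        · intro x'
          refine hβ _ (Or.inr fun ε => ?_)
          by_cases h : ε = β
          · rw [h, show β = (x, y) from Prod.ext hx.symm hy.symm]
            exact hxy
          · exact hβ _ (Or.inl h)
        · exact hrow y hy
      exact hS.trans (hS.column (hcol _ (hne _)) _ y) (hS.row hy _ x)
    · exact hS.trans (hS.row (hrow _ (hne _)) _ x) (hS.column (hcol x hx) _ y)
  exact hS.trans (hS.symm (hub δ hδ)) (hub ε hε)

lemma coarsen_self_iff (hS : IsConnectivity S) (v : ℕ × ℕ) : coarsen S v v ↔ GoodBlock S v :=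
  ⟨fun h => h.1, fun h => ⟨h, h, fun _ _ => hS.of_goodBlock h⟩⟩

end IsConnectivity

lemma GoodBlock.exists_of_ne {S : ℕ × ℕ → ℕ × ℕ → Prop} {v : ℕ × ℕ} (hv : GoodBlock S v)
    {δ ε : Fin 3 × Fin 3} (hne : δ ≠ ε) :
    S (subsite v δ) (subsite v δ) ∨ S (subsite v ε) (subsite v ε) := by
  by_contra! h
  exact hne (hv _ _ h.1 h.2)

/-- Of three pairs of sites that face each other across the boundary of two good blocks, at most
two contain a bad site. -/
lemma GoodBlock.exists_pair {S : ℕ × ℕ → ℕ × ℕ → Prop} {v w : ℕ × ℕ} (hv : GoodBlock S v)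
    (hw : GoodBlock S w) {f g : Fin 3 → Fin 3 × Fin 3} (hf : f.Injective) (hg : g.Injective) :
    ∃ i, S (subsite v (f i)) (subsite v (f i)) ∧ S (subsite w (g i)) (subsite w (g i)) := by
  have hv' : ∀ i j, i ≠ j → _ := fun i j hij => hv.exists_of_ne (hf.ne hij)
  have hw' : ∀ i j, i ≠ j → _ := fun i j hij => hw.exists_of_ne (hg.ne hij)
  have v01 := hv' 0 1 (by decide)
  have v02 := hv' 0 2 (by decide)
  have v12 := hv' 1 2 (by decide)
  have w01 := hw' 0 1 (by decide)
  have w02 := hw' 0 2 (by decide)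
  have w12 := hw' 1 2 (by decide)
  by_contra! h
  have h0 := h 0
  have h1 := h 1
  have h2 := h 2
  tauto

lemma IsConnectivity.coarsen {S : ℕ × ℕ → ℕ × ℕ → Prop} (hS : IsConnectivity S) :
    IsConnectivity (coarsen S) where
  symm h := ⟨h.2.1, h.1, fun δ ε hδ hε => hS.symm (h.2.2 ε δ hε hδ)⟩
  trans := by
    intro u v w huv hvw
    refine ⟨huv.1, hvw.2.1, fun δ ε hδ hε => ?_⟩
    rcases huv.2.1.exists_of_ne (show (0 : Fin 3 × Fin 3) ≠ 1 by decide) with h | h <;>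
      exact hS.trans (huv.2.2 _ _ hδ h) (hvw.2.2 _ _ h hε)
  right := by
    intro x y hv hw
    obtain ⟨i, hi, hi'⟩ := hv.1.exists_pair hw.1 (f := fun i => (2, i)) (g := fun i => (0, i))
      (fun i j h => congrArg Prod.snd h) (fun i j h => congrArg Prod.snd h)
    have h1 : S (subsite (x, y) (2, i)) (subsite (x + 1, y) (0, i)) := hS.right hi hi'
    exact ⟨hv.1, hw.1, fun δ ε hδ hε =>
      hS.trans (hS.trans (hv.2.2 _ _ hδ hi) h1) (hw.2.2 _ _ hi' hε)⟩
  up := by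
    intro x y hv hw
    obtain ⟨i, hi, hi'⟩ := hv.1.exists_pair hw.1 (f := fun i => (i, 2)) (g := fun i => (i, 0))
      (fun i j h => congrArg Prod.fst h) (fun i j h => congrArg Prod.fst h)
    have h1 : S (subsite (x, y) (i, 2)) (subsite (x, y + 1) (i, 0)) := hS.up hi hi'
    exact ⟨hv.1, hw.1, fun δ ε hδ hε =>
      hS.trans (hS.trans (hv.2.2 _ _ hδ hi) h1) (hw.2.2 _ _ hi' hε)⟩

lemma IsConnectivity.iterate {S : ℕ × ℕ → ℕ × ℕ → Prop} (hS : IsConnectivity S) (k : ℕ) :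
    IsConnectivity (_root_.coarsen^[k] S) := by
  induction k with
  | zero => exact hS
  | succ k ih =>
    rw [Function.iterate_succ_apply']
    exact ih.coarsen

/-- A relation between blocks of scale `k` descends to sites, because the block of each smaller
scale at the origin is good. -/
lemma exists_of_coarsen_iterate {S : ℕ × ℕ → ℕ × ℕ → Prop}
    (h0 : ∀ k, (coarsen^[k] S) (0, 0) (0, 0)) (k : ℕ) {w : ℕ × ℕ}
    (hw : (coarsen^[k] S) (0, 0) w) : ∃ t : ℕ × ℕ, 3 ^ k * w.1 ≤ t.1 ∧ S (0, 0) t := by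
  induction k generalizing w with
  | zero => exact ⟨w, by simp, hw⟩
  | succ k ih =>
    rw [Function.iterate_succ_apply'] at hw
    obtain ⟨ε, hε⟩ : ∃ ε, (coarsen^[k] S) (subsite w ε) (subsite w ε) := by
      rcases hw.2.1.exists_of_ne (show (0 : Fin 3 × Fin 3) ≠ 1 by decide) with h | h
      exacts [⟨_, h⟩, ⟨_, h⟩]
    obtain ⟨t, ht, hSt⟩ := ih (hw.2.2 0 ε (h0 k) hε)
    refine ⟨t, le_trans ?_ ht, hSt⟩
    rw [pow_succ, mul_assoc]
    exact Nat.mul_le_mul_left _ (Nat.le_add_right _ _)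

/-- If the blocks of all scales at the origin are good, then the origin is related to sites
arbitrarily far away. -/
lemma exists_far_of_coarsen_iterate {S : ℕ × ℕ → ℕ × ℕ → Prop}
    (h0 : ∀ k, (coarsen^[k] S) (0, 0) (0, 0)) (N : ℕ) : ∃ t : ℕ × ℕ, N ≤ t.1 ∧ S (0, 0) t := by
  have h1 := h0 (N + 1)
  rw [Function.iterate_succ_apply'] at h1
  obtain ⟨i, hi⟩ : ∃ i, (coarsen^[N] S) (subsite (0, 0) (2, i)) (subsite (0, 0) (2, i)) := by
    rcases h1.1.exists_of_ne (show ((2, 0) : Fin 3 × Fin 3) ≠ (2, 1) by decide) with h | h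
    exacts [⟨_, h⟩, ⟨_, h⟩]
  obtain ⟨t, ht, hSt⟩ := exists_of_coarsen_iterate h0 N (h1.2.2 0 (2, i) (h0 N) hi)
  refine ⟨t, le_trans ?_ ht, hSt⟩
  have h2 : N < 3 ^ N := Nat.lt_pow_self (by norm_num)
  have h3 : 1 ≤ (subsite (0, 0) (2, i)).1 := by simp [subsite]
  nlinarith

/-- Sets of sites such that all the sites of one of these sets are closed if the block `v` of scale
`k` is bad. -/
def badWitnesses : ℕ → ℕ × ℕ → Finset (Finset (ℕ × ℕ))
  | 0, v => {{v}}
  | k + 1, v => (Finset.univ.filter fun q : (Fin 3 × Fin 3) × (Fin 3 × Fin 3) => q.1 ≠ q.2).biUnion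
      fun q => Finset.image₂ (· ∪ ·) (badWitnesses k (subsite v q.1)) (badWitnesses k (subsite v q.2))

lemma exists_mem_badWitnesses {S : ℕ × ℕ → ℕ × ℕ → Prop} (hS : IsConnectivity S) (k : ℕ)
    (v : ℕ × ℕ) (hv : ¬ (coarsen^[k] S) v v) :
    ∃ F ∈ badWitnesses k v, ∀ s ∈ F, ¬ S s s := by
  induction k generalizing v with
  | zero => exact ⟨{v}, by simp [badWitnesses], by simpa using hv⟩
  | succ k ih =>
    rw [Function.iterate_succ_apply', (hS.iterate k).coarsen_self_iff, GoodBlock] at hv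
    push Not at hv
    obtain ⟨δ, ε, hδ, hε, hne⟩ := hv
    obtain ⟨F, hF, hF'⟩ := ih _ hδ
    obtain ⟨G, hG, hG'⟩ := ih _ hε
    refine ⟨F ∪ G, ?_, fun s hs => ?_⟩
    · simp only [badWitnesses, Finset.mem_biUnion]
      exact ⟨(δ, ε), by simpa using hne, Finset.mem_image₂_of_mem hF hG⟩
    · rcases Finset.mem_union.mp hs with h | h
      exacts [hF' s h, hG' s h]

lemma div_pow_of_mem_badWitnesses {k : ℕ} {v : ℕ × ℕ} {F : Finset (ℕ × ℕ)}
    (hF : F ∈ badWitnesses k v) {s : ℕ × ℕ} (hs : s ∈ F) : (s.1 / 3 ^ k, s.2 / 3 ^ k) = v := by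
  induction k generalizing v F with
  | zero =>
    rw [badWitnesses, Finset.mem_singleton] at hF
    subst hF
    rw [Finset.mem_singleton] at hs
    simp [hs]
  | succ k ih =>
    simp only [badWitnesses, Finset.mem_biUnion, Finset.mem_image₂] at hF
    obtain ⟨q, -, G, hG, H, hH, rfl⟩ := hF
    have h : ∀ δ, (s.1 / 3 ^ k, s.2 / 3 ^ k) = subsite v δ →
        (s.1 / 3 ^ (k + 1), s.2 / 3 ^ (k + 1)) = v := by
      intro δ hδ
      obtain ⟨h1, h2⟩ := Prod.ext_iff.mp hδ
      simp only [subsite] at h1 h2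
      rw [pow_succ, ← Nat.div_div_eq_div_mul, ← Nat.div_div_eq_div_mul, h1, h2]
      ext
      · change (3 * v.1 + δ.1) / 3 = v.1
        omega
      · change (3 * v.2 + δ.2) / 3 = v.2
        omega
    rcases Finset.mem_union.mp hs with hs | hs
    exacts [h _ (ih hG hs), h _ (ih hH hs)]

lemma card_of_mem_badWitnesses {k : ℕ} {v : ℕ × ℕ} {F : Finset (ℕ × ℕ)}
    (hF : F ∈ badWitnesses k v) : F.card = 2 ^ k := by
  induction k generalizing v F with
  | zero =>
    rw [badWitnesses, Finset.mem_singleton] at hF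
    simp [hF]
  | succ k ih =>
    simp only [badWitnesses, Finset.mem_biUnion, Finset.mem_image₂, Finset.mem_filter] at hF
    obtain ⟨q, ⟨-, hq⟩, G, hG, H, hH, rfl⟩ := hF
    rw [Finset.card_union_of_disjoint, ih hG, ih hH, pow_succ]
    · ring
    · refine Finset.disjoint_left.mpr fun s hs hs' => hq ?_
      have h := (div_pow_of_mem_badWitnesses hG hs).symm.trans (div_pow_of_mem_badWitnesses hH hs')
      simp only [subsite, Prod.ext_iff, add_right_inj, Fin.val_inj] at h
      exact Prod.ext h.1 h.2

/-- The number `a k` of witnesses satisfies `a (k + 1) ≤ 81 (a k) ^ 2`, since there are fewer than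
`9 ^ 2 = 81` pairs of distinct sites in a block. -/
lemma card_badWitnesses_le (k : ℕ) (v : ℕ × ℕ) : 81 * (badWitnesses k v).card ≤ 81 ^ 2 ^ k := by
  induction k generalizing v with
  | zero => simp [badWitnesses]
  | succ k ih =>
    have h1 : (badWitnesses (k + 1) v).card ≤ ∑ q : (Fin 3 × Fin 3) × (Fin 3 × Fin 3),
        (badWitnesses k (subsite v q.1)).card * (badWitnesses k (subsite v q.2)).card := by
      rw [badWitnesses]
      refine Finset.card_biUnion_le.trans ((Finset.sum_le_sum fun q _ =>
        Finset.card_image₂_le _ _ _).trans ?_)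
      exact Finset.sum_le_sum_of_subset (Finset.filter_subset _ _)
    calc 81 * (badWitnesses (k + 1) v).card
        ≤ ∑ q : (Fin 3 × Fin 3) × (Fin 3 × Fin 3), 81 *
          ((badWitnesses k (subsite v q.1)).card * (badWitnesses k (subsite v q.2)).card) := by
          rw [← Finset.mul_sum]
          exact Nat.mul_le_mul_left _ h1
      _ ≤ ∑ _q : (Fin 3 × Fin 3) × (Fin 3 × Fin 3), 81 ^ 2 ^ (k + 1) / 81 := by
          refine Finset.sum_le_sum fun q _ => ?_
          rw [Nat.le_div_iff_mul_le (by norm_num), pow_succ 2, pow_mul, sq]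
          calc _ = 81 * (badWitnesses k (subsite v q.1)).card *
                (81 * (badWitnesses k (subsite v q.2)).card) := by ring
            _ ≤ _ := Nat.mul_le_mul (ih _) (ih _)
      _ ≤ 81 ^ 2 ^ (k + 1) := by
          simp only [Finset.sum_const, Finset.card_univ, Fintype.card_prod, Fintype.card_fin,
            smul_eq_mul]
          exact Nat.mul_div_le _ _

/-! ### Percolation at large intensity -/

/-- The index of the cube in the quadrant of a coordinate plane that represents the site `a`. -/
def siteIndex (d : ℕ) (a : ℕ × ℕ) : Fin d → ℤ :=
  fun i => if i.val = 0 then a.1 else if i.val = 1 then a.2 else 0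

lemma siteIndex_injective (hd : 2 ≤ d) : Function.Injective (siteIndex d) := by
  intro a b hab
  have h0 := congrFun hab ⟨0, by omega⟩
  have h1 := congrFun hab ⟨1, by omega⟩
  simp only [siteIndex, if_true, one_ne_zero, if_false, Nat.cast_inj] at h0 h1
  exact Prod.ext h0 h1

namespace MarkedConfiguration

variable {M : Type*}

/-- The site `a` is occupied by the marked point `p`, whose mark belongs to `U`. -/
def Occupies (s : ℝ) (U : Set M) (a : ℕ × ℕ) (p : 𝔼[d] × M) : Prop :=
  p ∈ cube s (siteIndex d a) ×ˢ U

open Relation in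
/-- Two occupied sites are related if the points in their cubes with marks in `U` belong to the
same cluster. -/
def siteRel (h : StructuralFunction M) (s : ℝ) (U : Set M) (ω : MarkedConfiguration d M)
    (a b : ℕ × ℕ) : Prop :=
  (∃ p ∈ ω.carrier, Occupies s U a p) ∧ (∃ p ∈ ω.carrier, Occupies s U b p) ∧
    ∀ p ∈ ω.carrier, ∀ q ∈ ω.carrier, Occupies s U a p → Occupies s U b q →
      ReflTransGen (Linked h ω) p q

lemma siteRel_of_adjacent {h : StructuralFunction M} {s : ℝ} (hs : 0 < s) {U : Set M}
    (hU : ∀ a ∈ U, ∀ b ∈ U, d * (2 * s) ≤ h.toFun a b) {ω : MarkedConfiguration d M}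
    {a b : ℕ × ℕ} (hab : ∀ i, |siteIndex d a i - siteIndex d b i| ≤ 1)
    (ha : ∃ p ∈ ω.carrier, Occupies s U a p) (hb : ∃ p ∈ ω.carrier, Occupies s U b p) :
    siteRel h s U ω a b :=
  ⟨ha, hb, fun _ hp _ hq hpa hqb => .single ⟨hp, hq,
    (dist_le_of_mem_cube hs hab hpa.1 hqb.1).trans (hU _ hpa.2 _ hqb.2)⟩⟩

lemma isConnectivity_siteRel {h : StructuralFunction M} {s : ℝ} (hs : 0 < s) {U : Set M}
    (hU : ∀ a ∈ U, ∀ b ∈ U, d * (2 * s) ≤ h.toFun a b) (ω : MarkedConfiguration d M) :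
    IsConnectivity (siteRel h s U ω) where
  symm hab := ⟨hab.2.1, hab.1, fun p hp q hq hpb hqa =>
    reflTransGen_linked_symm (hab.2.2 q hq p hp hqa hpb)⟩
  trans := by
    rintro a b c hab hbc
    refine ⟨hab.1, hbc.2.1, fun p hp q hq hpa hqc => ?_⟩
    obtain ⟨r, hr, hrb⟩ := hab.2.1
    exact (hab.2.2 p hp r hr hpa hrb).trans (hbc.2.2 r hr q hq hrb hqc)
  right ha hb := by
    refine siteRel_of_adjacent hs hU (fun i => ?_) ha.1 hb.1
    simp only [siteIndex]
    split_ifs <;> simp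
  up ha hb := by
    refine siteRel_of_adjacent hs hU (fun i => ?_) ha.1 hb.1
    simp only [siteIndex]
    split_ifs <;> simp

lemma siteRel_self_iff {h : StructuralFunction M} {s : ℝ} (hs : 0 < s) {U : Set M}
    (hU : ∀ a ∈ U, ∀ b ∈ U, d * (2 * s) ≤ h.toFun a b) (ω : MarkedConfiguration d M)
    (a : ℕ × ℕ) : siteRel h s U ω a a ↔ ∃ p ∈ ω.carrier, Occupies s U a p :=
  ⟨fun h => h.1, fun ha => siteRel_of_adjacent hs hU (fun i => by simp) ha ha⟩

/-- If the blocks of all scales at the origin are good, then there is percolation. -/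
lemma percolates_of_coarsen_iterate (hd : 2 ≤ d) {h : StructuralFunction M} {s : ℝ} (hs : 0 < s)
    {U : Set M} {ω : MarkedConfiguration d M}
    (h0 : ∀ k, (coarsen^[k] (siteRel h s U ω)) (0, 0) (0, 0)) :
    Percolates (booleanGraph h ω) := by
  rw [percolates_iff]
  obtain ⟨p, hp, hp0⟩ := (h0 0).1
  refine ⟨p, hp, fun L => ?_⟩
  obtain ⟨N, hN⟩ := exists_nat_gt (L / s)
  obtain ⟨t, ht, hSt⟩ := exists_far_of_coarsen_iterate h0 N
  obtain ⟨q, hq, hqt⟩ := hSt.2.1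
  refine ⟨q, hSt.2.2 p hp q hq hp0 hqt, ?_⟩
  have h1 := ((mem_cube_iff hs).mp hqt.1 ⟨0, by omega⟩).1
  have h2 : q.1 ⟨0, by omega⟩ ≤ ‖q.1‖ :=
    (le_abs_self _).trans (PiLp.norm_apply_le q.1 ⟨0, by omega⟩)
  simp only [siteIndex, if_true, Int.cast_natCast] at h1
  have h3 : (N : ℝ) ≤ t.1 := by exact_mod_cast ht
  rw [div_lt_iff₀ hs] at hN
  nlinarith

variable [MeasurableSpace M]

lemma HasPoissonVoidProbabilities.measure_forall_closed (hd : 2 ≤ d)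
    {P : Measure (MarkedConfiguration d M)} {lam : ℝ≥0} {ν : Measure M} [IsProbabilityMeasure ν]
    (hP : HasPoissonVoidProbabilities P lam ν) {s : ℝ} (hs : 0 < s) {U : Set M}
    (hU : MeasurableSet U) (F : Finset (ℕ × ℕ)) :
    P {ω | ∀ a ∈ F, ¬ ∃ p ∈ ω.carrier, Occupies s U a p} =
      ENNReal.ofReal (Real.exp (-(lam * (s ^ d * ν.real U)))) ^ F.card := by
  have h1 : {ω : MarkedConfiguration d M | ∀ a ∈ F, ¬ ∃ p ∈ ω.carrier, Occupies s U a p} =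
      voidEvent ((⋃ a ∈ F, cube s (siteIndex d a)) ×ˢ U) := by
    ext ω
    simp only [mem_voidEvent, Set.mem_ofPred_eq, Occupies, Set.mem_prod, Set.mem_iUnion]
    grind
  have h2 : volume (⋃ a ∈ F, cube s (siteIndex d a)) = F.card * ENNReal.ofReal (s ^ d) := by
    rw [measure_biUnion_finset (fun a _ b _ hab => disjoint_cube ((siteIndex_injective hd).ne hab))
      fun a _ => measurableSet_cube hs _]
    simp [volume_cube hs]
  rw [h1, hP.measure_voidEvent (isSimpleRegion_prod
    ((Bornology.isBounded_biUnion_finset F).mpr fun a _ => isBounded_cube hs _)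
    (F.measurableSet_biUnion fun a _ => measurableSet_cube hs _) hU), measureReal_prod_prod,
    measureReal_def volume, h2, ENNReal.toReal_mul, ENNReal.toReal_natCast,
    ENNReal.toReal_ofReal (by positivity), ← ENNReal.ofReal_pow (Real.exp_pos _).le,
    ← Real.exp_nat_mul]
  congr 2
  ring

/-- If the probability that a site is closed is small, then percolation has positive
probability. -/
lemma HasPoissonVoidProbabilities.measure_percolates_ne_zero (hd : 2 ≤ d)
    {P : Measure (MarkedConfiguration d M)} {lam : ℝ≥0} {ν : Measure M} [IsProbabilityMeasure ν]
    (hP : HasPoissonVoidProbabilities P lam ν) {h : StructuralFunction M} {s : ℝ} (hs : 0 < s)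
    {U : Set M} (hUm : MeasurableSet U) (hU : ∀ a ∈ U, ∀ b ∈ U, d * (2 * s) ≤ h.toFun a b)
    (hlam : Real.exp (-(lam * (s ^ d * ν.real U))) ≤ 1 / 324) :
    P {ω | Percolates (booleanGraph h ω)} ≠ 0 := by
  have := hP.isProbabilityMeasure
  have hε : ENNReal.ofReal (Real.exp (-(lam * (s ^ d * ν.real U)))) ≤ ENNReal.ofReal (1 / 324) :=
    ENNReal.ofReal_le_ofReal hlam
  have hbad : ∀ k : ℕ, P {ω | ¬ (coarsen^[k] (siteRel h s U ω)) (0, 0) (0, 0)} ≤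
      ENNReal.ofReal ((1 / 4) ^ (k + 1)) := by
    intro k
    have h1 : {ω : MarkedConfiguration d M | ¬ (coarsen^[k] (siteRel h s U ω)) (0, 0) (0, 0)} ⊆
        ⋃ F ∈ badWitnesses k (0, 0), {ω | ∀ a ∈ F, ¬ ∃ p ∈ ω.carrier, Occupies s U a p} := by
      intro ω hω
      obtain ⟨F, hF, hFc⟩ := exists_mem_badWitnesses (isConnectivity_siteRel hs hU ω) k _ hω
      refine Set.mem_biUnion hF fun a ha => ?_
      rw [← siteRel_self_iff hs hU ω a]
      exact hFc a ha
    calc _ ≤ ∑ F ∈ badWitnesses k (0, 0),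
          P {ω | ∀ a ∈ F, ¬ ∃ p ∈ ω.carrier, Occupies s U a p} :=
          (measure_mono h1).trans (measure_biUnion_finset_le _ _)
      _ ≤ ∑ F ∈ badWitnesses k (0, 0), ENNReal.ofReal (1 / 324) ^ 2 ^ k := by
          refine Finset.sum_le_sum fun F hF => ?_
          rw [hP.measure_forall_closed hd hs hUm, card_of_mem_badWitnesses hF]
          gcongr
      _ ≤ (81 ^ 2 ^ k : ℕ) * ENNReal.ofReal (1 / 324) ^ 2 ^ k := by
          rw [Finset.sum_const, nsmul_eq_mul]
          gcongr
          exact le_trans (Nat.le_mul_of_pos_left _ (by norm_num)) (card_badWitnesses_le k (0, 0))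
      -- The bound on the probability is chosen so that `81 / 324 = 1 / 4`.
      _ = ENNReal.ofReal ((1 / 4) ^ 2 ^ k) := by
          rw [← ENNReal.ofReal_pow (by norm_num), ← ENNReal.ofReal_natCast,
            ← ENNReal.ofReal_mul (by positivity), Nat.cast_pow, ← mul_pow]
          norm_num
      _ ≤ _ := ENNReal.ofReal_le_ofReal
          (pow_le_pow_of_le_one (by norm_num) (by norm_num) Nat.lt_two_pow_self)
  have hsum : HasSum (fun k : ℕ => (1 / 4 : ℝ) ^ (k + 1)) (1 / 3) := by
    have := (hasSum_geometric_of_lt_one (r := (1 / 4 : ℝ)) (by norm_num) (by norm_num)).mul_left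
      (1 / 4)
    simp_rw [pow_succ']
    rwa [show (1 / 4 : ℝ) * (1 - 1 / 4)⁻¹ = 1 / 3 by norm_num] at this
  have hunion : P (⋃ k : ℕ, {ω | ¬ (coarsen^[k] (siteRel h s U ω)) (0, 0) (0, 0)}) ≤
      ENNReal.ofReal (1 / 3) := by
    refine (measure_iUnion_le _).trans ((ENNReal.tsum_le_tsum hbad).trans ?_)
    rw [← ENNReal.ofReal_tsum_of_nonneg (fun k => by positivity) hsum.summable, hsum.tsum_eq]
  intro hzero
  have hcover : (Set.univ : Set (MarkedConfiguration d M)) ⊆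
      {ω | Percolates (booleanGraph h ω)} ∪
        ⋃ k : ℕ, {ω | ¬ (coarsen^[k] (siteRel h s U ω)) (0, 0) (0, 0)} := by
    intro ω _
    by_cases hω : ∀ k, (coarsen^[k] (siteRel h s U ω)) (0, 0) (0, 0)
    · exact Or.inl (percolates_of_coarsen_iterate hd hs hω)
    · push Not at hω
      exact Or.inr (Set.mem_iUnion.mpr hω)
  have h1 : ENNReal.ofReal 1 ≤ ENNReal.ofReal (1 / 3) :=
    calc ENNReal.ofReal 1 = P Set.univ := by rw [measure_univ, ENNReal.ofReal_one]
      _ ≤ _ := (measure_mono hcover).trans (measure_union_le _ _)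
      _ ≤ ENNReal.ofReal (1 / 3) := by rwa [hzero, zero_add]
  have h2 := (ENNReal.ofReal_le_ofReal_iff (by norm_num)).mp h1
  norm_num at h2

/-! ### The critical intensity -/

/-- The structural function `min(h, R)`, whose edges have length at most `R`. -/
noncomputable def _root_.StructuralFunction.cap (h : StructuralFunction M) (R : ℝ) :
    StructuralFunction M where
  toFun a b := min (h.toFun a b) R
  symm a b := by rw [h.symm]

/-- Almost surely, all marks belong to a given set of full measure. -/
lemma HasPoissonVoidProbabilities.ae_forall_mem {P : Measure (MarkedConfiguration d M)}
    {lam : ℝ≥0} {ν : Measure M} [IsProbabilityMeasure ν]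
    (hP : HasPoissonVoidProbabilities P lam ν) {U : Set M} (hU : MeasurableSet U)
    (hνU : ν Uᶜ = 0) : ∀ᵐ ω ∂P, ∀ p ∈ ω.carrier, p.2 ∈ U := by
  have := hP.isProbabilityMeasure
  have h1 : ∀ j : ℕ, ∀ᵐ ω ∂P, ω ∈ voidEvent (shell d j ×ˢ Uᶜ) := by
    intro j
    have hA := isSimpleRegion_prod (isBounded_shell d j) (measurableSet_shell d j) hU.compl
    have h := hP.measure_voidEvent hA
    rw [measureReal_prod_prod, measureReal_def ν, hνU] at h
    exact (mem_ae_iff_prob_eq_one (measurableSet_voidEvent hA.measurableSet)).mpr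
      (by simpa using h)
  filter_upwards [ae_all_iff.mpr h1] with ω hω p hp
  by_contra hpU
  exact mem_voidEvent.mp (hω ⌊‖p.1‖⌋₊) p hp ⟨rfl, hpU⟩

variable [MeasurableSingletonClass M]

/-- A structural function with bounded edges on a set of marks of full measure, and with edges of
length bounded below on a set of marks of positive measure, has a nontrivial critical intensity. -/
theorem exists_criticalIntensity (hd : 2 ≤ d) {h : StructuralFunction M}
    (hh : Measurable fun p : M × M => h.toFun p.1 p.2) {ν : Measure M} [IsProbabilityMeasure ν]
    {K U : Set M} (hK : MeasurableSet K) (hνK : ν Kᶜ = 0) {R : ℝ} (hR : 0 < R)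
    (hhR : ∀ a ∈ K, ∀ b ∈ K, h.toFun a b ≤ R) (hU : MeasurableSet U) (hνU : ν U ≠ 0) {r : ℝ}
    (hr : 0 < r) (hhr : ∀ a ∈ U, ∀ b ∈ U, r ≤ h.toFun a b) :
    ∃ lam_c : ℝ≥0, 0 < lam_c ∧
      ∀ (lam : ℝ≥0) (P : Measure (MarkedConfiguration d M)),
        0 < lam → IsRandomizedPoissonProcess P lam ν →
          (lam_c < lam → ∀ᵐ ω ∂P, Percolates (booleanGraph h ω)) ∧
          (lam < lam_c → ∀ᵐ ω ∂P, ¬ Percolates (booleanGraph h ω)) := by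
  have : Nontrivial 𝔼[d] :=
    Module.nontrivial_of_finrank_pos (R := ℝ) (by rw [finrank_euclideanSpace_fin]; omega)
  have hcapR : ∀ a b, (h.cap R).toFun a b ≤ R := fun a b => min_le_right _ _
  have hcap : ∀ {lam : ℝ≥0} {P : Measure (MarkedConfiguration d M)},
      HasPoissonVoidProbabilities P lam ν →
        ∀ᵐ ω ∂P, (Percolates (booleanGraph h ω) ↔ Percolates (booleanGraph (h.cap R) ω)) := by
    intro lam P hP
    filter_upwards [hP.ae_forall_mem hK hνK] with ω hω
    exact percolates_congr fun p hp q hq => (min_eq_left (hhR _ (hω p hp) _ (hω q hq))).symm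
  have hT := measurableSet_percolates (d := d) hh
  -- The zero-one law applies to the capped structural function, with edges of bounded length.
  have hzo : ∀ {lam : ℝ≥0} {P : Measure (MarkedConfiguration d M)},
      HasPoissonVoidProbabilities P lam ν → P {ω | Percolates (booleanGraph h ω)} ≠ 0 →
        ∀ᵐ ω ∂P, Percolates (booleanGraph h ω) := by
    intro lam P hP h0
    have := hP.isProbabilityMeasure
    have hTc := measurableSet_percolates (d := d) (h := h.cap R) (hh.min measurable_const)
    have heq : P {ω | Percolates (booleanGraph h ω)} =
        P {ω | Percolates (booleanGraph (h.cap R) ω)} :=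
      measure_congr (Filter.eventuallyEq_set.mpr (hcap hP))
    rcases hP.measure_eq_zero_or_one hTc fun n =>
      Set.ext fun ω => percolates_outside_iff (h.cap R) hcapR n ω with h1 | h1
    · exact absurd (heq.trans h1) h0
    · exact (mem_ae_iff_prob_eq_one hT).mpr (heq.trans h1)
  -- Absence of percolation up to the intensity `lam₀`.
  obtain ⟨lam₀, hlam₀, hlow⟩ : ∃ lam₀ : ℝ≥0, 0 < lam₀ ∧ ∀ (lam : ℝ≥0)
      (P : Measure (MarkedConfiguration d M)), lam ≤ lam₀ → IsRandomizedPoissonProcess P lam ν →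
        ∀ᵐ ω ∂P, ¬ Percolates (booleanGraph h ω) := by
    have hpos : 0 < (R ^ d).toNNReal := Real.toNNReal_pos.mpr (by positivity)
    refine ⟨1 / 2 / (3 ^ d * (R ^ d).toNNReal), by positivity, fun lam P hlam hP => ?_⟩
    have h1 := hP.poisson_points.ae_not_percolates hR hcapR (by
      rw [le_div_iff₀ (by positivity)] at hlam
      calc _ = lam * (3 ^ d * (R ^ d).toNNReal) := by ring
        _ ≤ _ := hlam)
    filter_upwards [h1, hcap hP.hasPoissonVoidProbabilities] with ω hω hω'
    rwa [hω']
  -- Percolation from the intensity `lam₁` on.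
  obtain ⟨lam₁, hhigh⟩ : ∃ lam₁ : ℝ≥0, ∀ (lam : ℝ≥0)
      (P : Measure (MarkedConfiguration d M)), lam₁ ≤ lam → IsRandomizedPoissonProcess P lam ν →
        P {ω | Percolates (booleanGraph h ω)} ≠ 0 := by
    have hd' : (0 : ℝ) < d := by exact_mod_cast (by omega : 0 < d)
    -- Points in adjacent cubes of side `s` are at distance at most `d * (2 * s) = r`.
    set s : ℝ := r / (d * 2)
    have hs : 0 < s := by positivity
    have hsr : d * (2 * s) = r := by
      simp only [s]
      field_simp
    have hq : 0 < s ^ d * ν.real U :=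
      mul_pos (by positivity) (ENNReal.toReal_pos hνU (measure_ne_top _ _))
    refine ⟨(Real.log 324 / (s ^ d * ν.real U)).toNNReal, fun lam P hlam hP => ?_⟩
    refine hP.hasPoissonVoidProbabilities.measure_percolates_ne_zero hd hs hU
      (fun a ha b hb => hsr.le.trans (hhr a ha b hb)) ?_
    have h1 := (Real.toNNReal_le_iff_le_coe).mp hlam
    rw [div_le_iff₀ hq] at h1
    rw [Real.exp_neg, one_div]
    gcongr
    rwa [← Real.log_le_iff_le_exp (by norm_num)]
  -- The supremum of the intensities without percolation is critical. The number `lam₀` is put in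
  -- so that the set is nonempty even if there were no process with such an intensity.
  set A : Set ℝ≥0 := {lam | lam = lam₀ ∨ ∃ P : Measure (MarkedConfiguration d M),
    0 < lam ∧ IsRandomizedPoissonProcess P lam ν ∧ P {ω | Percolates (booleanGraph h ω)} = 0}
  have hA : BddAbove A := by
    refine ⟨max lam₀ lam₁, ?_⟩
    rintro lam (rfl | ⟨P, -, hP, h0⟩)
    · exact le_max_left _ _
    · by_contra! hlt
      exact hhigh lam P ((le_max_right _ _).trans hlt.le) hP h0
  have hmem : lam₀ ∈ A := Or.inl rfl
  refine ⟨sSup A, hlam₀.trans_le (le_csSup hA hmem), fun lam P hlam hP => ⟨fun hlt => ?_,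
    fun hlt => ?_⟩⟩
  · refine hzo hP.hasPoissonVoidProbabilities fun h0 => ?_
    exact absurd (le_csSup hA (Or.inr ⟨P, hlam, hP, h0⟩)) (not_le.mpr hlt)
  · obtain ⟨lam', hlam', hlt'⟩ := exists_lt_of_lt_csSup ⟨_, hmem⟩ hlt
    rcases hlam' with rfl | ⟨Q, -, hQ, h0⟩
    · exact hlow lam P hlt'.le hP
    · have h1 := hP.hasPoissonVoidProbabilities.measure_le_of_lt (by omega)
        hQ.hasPoissonVoidProbabilities hlam hlt' hT fun ω ω' hω => percolates_mono h hω
      rw [h0] at h1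
      have h2 := le_antisymm h1 zero_le
      exact measure_eq_zero_iff_ae_notMem.mp h2

end MarkedConfiguration

theorem lemma7p1 (d : ℕ) (hd : 2 ≤ d) (h : StructuralFunction ℝ≥0)
    (hh : (∃ γ : ℝ, 0 < γ ∧ h = StructuralFunction.sumPow γ) ∨
      h = StructuralFunction.minKernel ∨ h = StructuralFunction.maxKernel)
    (ν : Measure ℝ≥0) [IsProbabilityMeasure ν]
    (hν_bdd : Bornology.IsBounded ν.support) (hν_zero : ν {0} ≠ 1) :
    ∃ lam_c : ℝ≥0, 0 < lam_c ∧
      ∀ (lam : ℝ≥0) (P : Measure (MarkedConfiguration d ℝ≥0)),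
        0 < lam → IsRandomizedPoissonProcess P lam ν →
          (lam_c < lam → ∀ᵐ ω ∂P, Percolates (booleanGraph h ω)) ∧
          (lam < lam_c → ∀ᵐ ω ∂P, ¬ Percolates (booleanGraph h ω)) := by
  obtain ⟨K, hK0, hK⟩ : ∃ K : ℝ≥0, 0 < K ∧ ν (Set.Iic K)ᶜ = 0 := by
    obtain ⟨K, hK⟩ := hν_bdd.bddAbove
    refine ⟨max K 1, by positivity, measure_mono_null ?_ Measure.support_mem_ae⟩
    exact Set.compl_subset_compl.mpr fun a ha => (hK ha).trans (le_max_left _ _)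
  obtain ⟨t, ht, hνt⟩ : ∃ t : ℝ≥0, 0 < t ∧ ν (Set.Ici t) ≠ 0 := by
    by_contra! hcon
    refine hν_zero ((prob_compl_eq_zero_iff (measurableSet_singleton _)).mp ?_)
    refine measure_mono_null (fun a ha => ?_)
      (measure_iUnion_null fun n : ℕ => hcon (1 / (n + 1)) (by positivity))
    obtain ⟨n, hn⟩ := exists_nat_one_div_lt (NNReal.coe_pos.mpr (pos_iff_ne_zero.mpr ha))
    exact Set.mem_iUnion.mpr ⟨n, by exact_mod_cast hn.le⟩
  have hmeas : Measurable fun p : ℝ≥0 × ℝ≥0 => h.toFun p.1 p.2 := by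
    rcases hh with ⟨γ, -, rfl⟩ | rfl | rfl
    · simp only [StructuralFunction.sumPow]
      fun_prop
    · simp only [StructuralFunction.minKernel]
      fun_prop
    · simp only [StructuralFunction.maxKernel]
      fun_prop
  have hmono : ∀ a b a' b', a ≤ a' → b ≤ b' → h.toFun a b ≤ h.toFun a' b' := by
    intro a b a' b' ha hb
    have ha' : (a : ℝ) ≤ a' := by exact_mod_cast ha
    have hb' : (b : ℝ) ≤ b' := by exact_mod_cast hb
    rcases hh with ⟨γ, hγ, rfl⟩ | rfl | rfl
    · exact Real.rpow_le_rpow (by positivity) (by linarith) hγ.le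
    · exact min_le_min ha' hb'
    · exact max_le_max ha' hb'
  have hpos : ∀ a, 0 < a → 0 < h.toFun a a := by
    intro a ha
    have ha' : (0 : ℝ) < a := by exact_mod_cast ha
    rcases hh with ⟨γ, hγ, rfl⟩ | rfl | rfl
    · exact Real.rpow_pos_of_pos (by linarith) γ
    · exact lt_min ha' ha'
    · exact lt_max_of_lt_left ha'
  exact MarkedConfiguration.exists_criticalIntensity hd hmeas measurableSet_Iic hK (hpos K hK0)
    (fun a ha b hb => hmono a b K K ha hb) measurableSet_Ici hνt (hpos t ht)
    fun a ha b hb => hmono t t a b ha hb
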